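/- Let $\gamma_1,\gamma_2\in(0,1)$, let $W$ be a white noise on $\mathbb R^2$ (a centered Gaussian family $(W(h))_{h\in L^2(\mathbb R^2;\mathbb R)}$ with $\mathbb E[W(h)W(g)]=\langle h,g\rangle$, extended complex-linearly to $L^2(\mathbb R^2;\mathbb C)$), and let $\hat W$ be its Fourier transform, $\hat W(f)=W(\hat f)$, where $f\mapsto\hat f$ is the unitary Fourier transform on $L^2(\mathbb R^2;\mathbb C)$. For $s,t\in[0,1]$ put $$Q_{s;t}(\xi,\eta)=\frac{e^{\imath s\xi}-1}{|\xi|^{\gamma_1+1/2}}\,\frac{e^{\imath t\eta}-1}{|\eta|^{\gamma_2+1/2}},\qquad c_{\gamma_1,\gamma_2}=\prod_{i=1}^2\Big(\int_{\mathbb R}\frac{|e^{\imath\xi}-1|^2}{|\xi|^{2\gamma_i+1}}\,d\xi\Big)^{-1/2}.$$ Let $x$ be the fractional Brownian sheet on $[0,1]^2$ with Hurst parameters $\gamma_1,\gamma_2$ given by its harmonizable representation, and let $x^n$ be its frequency cutoff at level $n$: $$x_{s;t}=c_{\gamma_1,\gamma_2}\,\hat W(Q_{s;t}),\qquad x^n_{s;t}=c_{\gamma_1,\gamma_2}\,\hat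 W\big(Q_{s;t}\mathbf 1_{\{|\xi|\le n,\,|\eta|\le n\}}\big)\quad\text{almost surely, for all } s,t\in[0,1],$$ where continuous versions of $x$ and of each $x^n$ are taken. For $f:[0,1]^2\to\mathbb R$ and $\alpha,\beta>0$ write $$\|f\|_{\alpha,\beta}=\sup_{s_1\ne s_2,\;t_1\neq t_2}\frac{|f_{s_2;t_2}-f_{s_2;t_1}-f_{s_1;t_2}+f_{s_1;t_1}|}{|s_2-s_1|^{\alpha}\,|t_2-t_1|^{\beta}}.$$ Then, for all real $p>1$ and all $0<\varepsilon<\min(\gamma_1,\gamma_2)$, $$\lim_{n\to\infty}\mathbb E\left[\|x^n-x\|^p_{\gamma_1-\varepsilon,\gamma_2-\varepsilon}\right]=0.$$ In addition, there exists $\lambda>0$ such that $$\sup_{n\in\mathbb N}\mathbb E\left[e^{\lambda\sup_{(s,t)\in[0,1]^2}|x^n_{s;t}|^2}\right]<+\infty.$$ -/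

import Mathlib

open MeasureTheory ProbabilityTheory Filter Topology
open scoped ENNReal FourierTransform unitInterval

namespace FracSheet

/-- The (frequency) plane `ℝ²` with its Euclidean structure. -/
abbrev Plane : Type := EuclideanSpace ℝ (Fin 2)

/-- White noise on the plane (isonormal Gaussian process over `L²(ℝ²; ℝ)`): a centered Gaussian
family indexed by `L²(ℝ²; ℝ)` with covariance `E[W(f) W(g)] = ⟨f, g⟩`. -/
structure IsWhiteNoise {Ω : Type*} [MeasurableSpace Ω] (P : Measure Ω)
    (W : Lp ℝ 2 (volume : Measure Plane) → Ω → ℝ) : Prop where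
  gaussian : IsGaussianProcess W P
  centered : ∀ f, ∫ ω, W f ω ∂P = 0
  covariance : ∀ f g, ∫ ω, W f ω * W g ω ∂P = inner ℝ f g

/-- The Fourier transform `Ŵ` of the white noise: `Ŵ(f) = W(𝓕 f)` for `f ∈ L²(ℝ²; ℂ)`, where
`W` is extended complex linearly and `𝓕` is the (unitary) Fourier transform on `L²`. -/
noncomputable def fourierNoise {Ω : Type*} (W : Lp ℝ 2 (volume : Measure Plane) → Ω → ℝ)
    (f : Lp ℂ 2 (volume : Measure Plane)) (ω : Ω) : ℂ :=
  (W (Complex.reCLM.compLp (𝓕 f)) ω : ℂ) + Complex.I * (W (Complex.imCLM.compLp (𝓕 f)) ω : ℂ)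

/-- The one-parameter harmonizable kernel `(e^{i s ξ} - 1) / |ξ|^{γ + 1/2}`. -/
noncomputable def kernelOne (γ s ξ : ℝ) : ℂ :=
  (Complex.exp (Complex.I * ((s * ξ : ℝ) : ℂ)) - 1) / ((|ξ| ^ (γ + 1 / 2) : ℝ) : ℂ)

/-- The kernel `Q_{s;t}(ξ, η)` of the fractional Brownian sheet. -/
noncomputable def kernelQ (γ₁ γ₂ s t : ℝ) (z : Plane) : ℂ :=
  kernelOne γ₁ s (z 0) * kernelOne γ₂ t (z 1)

/-- The frequencies `(ξ, η)` with `|ξ|, |η| ≤ n`. -/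
def cutoff (n : ℕ) : Set Plane := {z | |z 0| ≤ n ∧ |z 1| ≤ n}

theorem measurable_kernelOne (γ s : ℝ) : Measurable (kernelOne γ s) := by
  unfold kernelOne
  fun_prop

theorem measurable_kernelQ (γ₁ γ₂ s t : ℝ) : Measurable (kernelQ γ₁ γ₂ s t) := by
  unfold kernelQ
  have h0 : Measurable fun z : Plane => z 0 := by fun_prop
  have h1 : Measurable fun z : Plane => z 1 := by fun_prop
  exact ((measurable_kernelOne γ₁ s).comp h0).mul ((measurable_kernelOne γ₂ t).comp h1)

theorem measurableSet_cutoff (n : ℕ) : MeasurableSet (cutoff n) := by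
  have h0 : Measurable fun z : Plane => |z 0| := by fun_prop
  have h1 : Measurable fun z : Plane => |z 1| := by fun_prop
  exact (measurableSet_le h0 measurable_const).inter (measurableSet_le h1 measurable_const)

theorem norm_sq_kernelOne {γ s ξ : ℝ} (hξ : 0 < ξ) :
    ‖kernelOne γ s ξ‖ ^ 2
      = ‖Complex.exp (Complex.I * ((s * ξ : ℝ) : ℂ)) - 1‖ ^ 2 * ξ ^ (-(2 * γ + 1)) := by
  unfold kernelOne
  rw [norm_div, div_pow, Complex.norm_real, Real.norm_eq_abs, abs_of_pos hξ,
    abs_of_pos (Real.rpow_pos_of_pos hξ _), div_eq_mul_inv, Real.rpow_neg hξ.le,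
    ← Real.rpow_natCast (ξ ^ (γ + 1 / 2)) 2, ← Real.rpow_mul hξ.le]
  norm_num
  left
  congr 1
  ring

theorem integrableOn_kernelOne {γ : ℝ} (hγ : γ ∈ Set.Ioo (0 : ℝ) 1) (s : ℝ) :
    IntegrableOn (fun ξ => ‖kernelOne γ s ξ‖ ^ 2) (Set.Ioi 0) := by
  have hmeas : AEStronglyMeasurable (fun ξ => ‖kernelOne γ s ξ‖ ^ 2) volume :=
    ((measurable_kernelOne γ s).norm.pow_const 2).aestronglyMeasurable
  rw [← Set.Ioc_union_Ioi_eq_Ioi (zero_le_one' ℝ)]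
  refine IntegrableOn.union ?_ ?_
  · have h : IntegrableOn (fun ξ : ℝ => s ^ 2 * ξ ^ (1 - 2 * γ)) (Set.Ioc 0 1) := by
      have := intervalIntegral.intervalIntegrable_rpow' (a := 0) (b := 1) (r := 1 - 2 * γ)
        (by linarith [hγ.2])
      exact ((intervalIntegrable_iff_integrableOn_Ioc_of_le zero_le_one).1 this).const_mul _
    refine Integrable.mono' h hmeas.restrict ?_
    filter_upwards [ae_restrict_mem measurableSet_Ioc] with ξ hξ
    have hpos : 0 < ξ := hξ.1
    rw [Real.norm_of_nonneg (by positivity), norm_sq_kernelOne hpos]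
    have hb := Real.norm_exp_I_mul_ofReal_sub_one_le (x := s * ξ)
    have h2 : ‖Complex.exp (Complex.I * ((s * ξ : ℝ) : ℂ)) - 1‖ ^ 2 ≤ s ^ 2 * ξ ^ 2 := by
      calc _ ≤ ‖s * ξ‖ ^ 2 := by gcongr
        _ = s ^ 2 * ξ ^ 2 := by rw [Real.norm_eq_abs, sq_abs, mul_pow]
    calc _ ≤ s ^ 2 * ξ ^ 2 * ξ ^ (-(2 * γ + 1)) := by gcongr
      _ = s ^ 2 * ξ ^ (1 - 2 * γ) := by
        rw [mul_assoc, ← Real.rpow_natCast ξ 2, ← Real.rpow_add hpos]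
        congr 2
        push_cast
        ring
  · have h : IntegrableOn (fun ξ : ℝ => 4 * ξ ^ (-(2 * γ + 1))) (Set.Ioi 1) :=
      (integrableOn_Ioi_rpow_of_lt (by linarith [hγ.1]) one_pos).const_mul _
    refine Integrable.mono' h hmeas.restrict ?_
    filter_upwards [ae_restrict_mem measurableSet_Ioi] with ξ hξ
    have hpos : 0 < ξ := lt_trans one_pos hξ
    rw [Real.norm_of_nonneg (by positivity), norm_sq_kernelOne hpos]
    have hb : ‖Complex.exp (Complex.I * ((s * ξ : ℝ) : ℂ)) - 1‖ ≤ 2 := by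
      refine (norm_sub_le _ _).trans ?_
      rw [mul_comm, Complex.norm_exp_ofReal_mul_I, norm_one]
      norm_num
    have h2 : ‖Complex.exp (Complex.I * ((s * ξ : ℝ) : ℂ)) - 1‖ ^ 2 ≤ 4 := by
      calc _ ≤ (2 : ℝ) ^ 2 := by gcongr
        _ = 4 := by norm_num
    gcongr

theorem integrable_kernelOne {γ : ℝ} (hγ : γ ∈ Set.Ioo (0 : ℝ) 1) (s : ℝ) :
    Integrable (fun ξ => ‖kernelOne γ s ξ‖ ^ 2) := by
  rw [← integrableOn_univ, ← Set.Iic_union_Ioi (a := (0 : ℝ))]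
  refine IntegrableOn.union ?_ (integrableOn_kernelOne hγ s)
  rw [integrableOn_Iic_iff_integrableOn_Iio]
  have h := ((Measure.measurePreserving_neg (volume : Measure ℝ)).integrableOn_comp_preimage
    (MeasurableEquiv.neg ℝ).measurableEmbedding).2 (integrableOn_kernelOne hγ (-s))
  have hset : (Neg.neg ⁻¹' Set.Ioi (0 : ℝ)) = Set.Iio 0 := by ext; simp
  rw [hset] at h
  refine h.congr_fun (fun ξ _ => ?_) measurableSet_Iio
  simp [kernelOne]

theorem memLp_kernelQ {γ₁ γ₂ : ℝ} (h₁ : γ₁ ∈ Set.Ioo (0 : ℝ) 1) (h₂ : γ₂ ∈ Set.Ioo (0 : ℝ) 1)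
    (s t : ℝ) : MemLp (kernelQ γ₁ γ₂ s t) 2 (volume : Measure Plane) := by
  refine (memLp_two_iff_integrable_sq_norm
    (measurable_kernelQ γ₁ γ₂ s t).aestronglyMeasurable).2 ?_
  have h : Integrable (fun x : Fin 2 → ℝ =>
      ∏ i, (![fun ξ => ‖kernelOne γ₁ s ξ‖ ^ 2, fun ξ => ‖kernelOne γ₂ t ξ‖ ^ 2] i) (x i))
      (Measure.pi fun _ => volume) := by
    refine Integrable.fintype_prod (fun i => ?_)
    fin_cases i
    · exact integrable_kernelOne h₁ s
    · exact integrable_kernelOne h₂ t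
  have h' := ((PiLp.volume_preserving_ofLp (Fin 2)).integrable_comp_emb
    (MeasurableEquiv.toLp 2 (Fin 2 → ℝ)).symm.measurableEmbedding).2 h
  refine h'.congr (Eventually.of_forall fun z => ?_)
  simp [kernelQ, mul_pow]

/-- `Q_{s;t}` as an element of `L²(ℝ²; ℂ)`. -/
noncomputable def kernelLp {γ₁ γ₂ : ℝ} (h₁ : γ₁ ∈ Set.Ioo (0 : ℝ) 1)
    (h₂ : γ₂ ∈ Set.Ioo (0 : ℝ) 1) (s t : ℝ) : Lp ℂ 2 (volume : Measure Plane) :=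
  (memLp_kernelQ h₁ h₂ s t).toLp (kernelQ γ₁ γ₂ s t)

/-- The truncated kernel `Q_{s;t} 1_{|ξ|, |η| ≤ n}` as an element of `L²(ℝ²; ℂ)`. -/
noncomputable def kernelCutLp {γ₁ γ₂ : ℝ} (h₁ : γ₁ ∈ Set.Ioo (0 : ℝ) 1)
    (h₂ : γ₂ ∈ Set.Ioo (0 : ℝ) 1) (n : ℕ) (s t : ℝ) : Lp ℂ 2 (volume : Measure Plane) :=
  ((memLp_kernelQ h₁ h₂ s t).indicator (measurableSet_cutoff n)).toLp
    ((cutoff n).indicator (kernelQ γ₁ γ₂ s t))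

/-- The one-parameter normalization: `normConst γ ^ 2 * ∫ |e^{iξ} - 1|² / |ξ|^{2γ+1} dξ = 1`. -/
noncomputable def normConst (γ : ℝ) : ℝ := (Real.sqrt (∫ ξ : ℝ, ‖kernelOne γ 1 ξ‖ ^ 2))⁻¹

/-- `x` is (a continuous version of) the fractional Brownian sheet with Hurst parameters
`γ₁, γ₂` given by its harmonizable representation `x_{s;t} = c_{γ₁,γ₂} Ŵ(Q_{s;t})`. The constant
`c_{γ₁,γ₂}` is the one for which `E[x_{s;t}²] = s^{2γ₁} t^{2γ₂}`. -/
structure IsSheet {Ω : Type*} [MeasurableSpace Ω] (P : Measure Ω)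
    (W : Lp ℝ 2 (volume : Measure Plane) → Ω → ℝ) {γ₁ γ₂ : ℝ} (h₁ : γ₁ ∈ Set.Ioo (0 : ℝ) 1)
    (h₂ : γ₂ ∈ Set.Ioo (0 : ℝ) 1) (x : I → I → Ω → ℝ) : Prop where
  repr : ∀ s t : I, ∀ᵐ ω ∂P,
    (x s t ω : ℂ) = ((normConst γ₁ * normConst γ₂ : ℝ) : ℂ) * fourierNoise W (kernelLp h₁ h₂ s t) ω
  continuous_paths : ∀ᵐ ω ∂P, Continuous fun z : I × I => x z.1 z.2 ω

/-- `y` is (a continuous version of) the frequency cutoff at level `n` of that sheet: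
`y_{s;t} = c_{γ₁,γ₂} Ŵ(Q_{s;t} 1_{|ξ|, |η| ≤ n})`. -/
structure IsCutoffSheet {Ω : Type*} [MeasurableSpace Ω] (P : Measure Ω)
    (W : Lp ℝ 2 (volume : Measure Plane) → Ω → ℝ) {γ₁ γ₂ : ℝ} (h₁ : γ₁ ∈ Set.Ioo (0 : ℝ) 1)
    (h₂ : γ₂ ∈ Set.Ioo (0 : ℝ) 1) (n : ℕ) (y : I → I → Ω → ℝ) : Prop where
  repr : ∀ s t : I, ∀ᵐ ω ∂P,
    (y s t ω : ℂ)
      = ((normConst γ₁ * normConst γ₂ : ℝ) : ℂ) * fourierNoise W (kernelCutLp h₁ h₂ n s t) ω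
  continuous_paths : ∀ᵐ ω ∂P, Continuous fun z : I × I => y z.1 z.2 ω

/-- The planar (rectangular) increment of `f` over `[s₁, s₂] × [t₁, t₂]`. -/
def planarIncr (f : I → I → ℝ) (s₁ s₂ t₁ t₂ : I) : ℝ :=
  f s₂ t₂ - f s₂ t₁ - f s₁ t₂ + f s₁ t₁

/-- The planar Hölder (semi)norm `‖f‖_{α, β}` of a function on `[0,1]²`, as an extended
nonnegative number. -/
noncomputable def planarHolder (α β : ℝ) (f : I → I → ℝ) : ℝ≥0∞ :=
  ⨆ (s₁ : I) (s₂ : I) (t₁ : I) (t₂ : I) (_ : s₁ ≠ s₂) (_ : t₁ ≠ t₂),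
    ENNReal.ofReal (|planarIncr f s₁ s₂ t₁ t₂|
      / (|(s₂ : ℝ) - (s₁ : ℝ)| ^ α * |(t₂ : ℝ) - (t₁ : ℝ)| ^ β))

end FracSheet

/-!
Write `x^n - x` and `x^n` as `c W(Re 𝓕 φ_{s;t})` almost surely, where `φ` is the truncated kernel
minus the full one, or the truncated kernel. Since `W` preserves inner products it is almost surely
additive, so every rectangular increment is a centered Gaussian variable whose variance is, by
Plancherel, at most `c²` times the squared `L²` norm of the increment of `φ`
(`hasGaussianIncr_of_ae_eq`). The kernel factorizes and its increments satisfy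
`|k(s₂) - k(s₁)| = |k(s₂ - s₁)|`. Scaling in `ξ` therefore bounds the variance of the increments of
`x^n` by a constant times `|Δs|^{2γ₁} |Δt|^{2γ₂}`, uniformly in `n`
(`norm_sq_rectIncr_kernelCutLp_le`). For `x^n - x` only frequencies with `|ξ| > n` or `|η| > n`
remain; there a factor `|ξ|^{-δ}` or `|η|^{-δ}` can be split off, which gives the variance bound
`C n^{-2δ} |Δs|^{2(γ₁-δ)} |Δt|^{2(γ₂-δ)}` (`norm_sq_rectIncr_cut_sub_le`).

Pathwise, dyadic chaining in each of the two variables bounds all rectangular increments of a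
continuous function by those over dyadic rectangles (`abs_planarIncr_le_of_dyadic`). Both assertions
then follow from one functional, `dyadicSum`: the sum over all dyadic rectangles of
`Z^{2m} exp(lam Z²)`, `Z` being the increment divided by the side lengths to the powers `α`, `β`.
For a Gaussian `Z` of variance `v` with `lam v ≤ 1/4` the mean of this weight is at most `C_m v^m`,
and for `m` large the power `v^m` beats the number of dyadic rectangles
(`HasGaussianIncr.lintegral_dyadicSum_le`).

* With `lam = 0`, the planar Hölder norm to the power `2m` is at most a constant times the
  functional (`planarHolder_le_dyadicSum`), whose mean tends to zero with `n`; Jensen's inequality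
  passes from the exponent `2m` to `p`.
* With `lam > 0`, `exp(lam Z²) ≤ e + lam^m Z^{2m} exp(lam Z²)` bounds every `Z`, and so by chaining
  the supremum of a path vanishing on the axes (`exp_iSup_sq_le_dyadicSum`). The mean of the
  resulting bound does not depend on `n`.
-/

namespace FracSheet

/-! ### Dyadic chaining for functions on the unit interval and the unit square -/

/-- The dyadic point `i / 2 ^ j`, clamped to `[0, 1]`. -/
noncomputable def dyadicPt (j i : ℕ) : I := Set.projIcc 0 1 zero_le_one ((i : ℝ) / 2 ^ j)

theorem coe_dyadicPt {j i : ℕ} (h : i ≤ 2 ^ j) : (dyadicPt j i : ℝ) = i / 2 ^ j := by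
  have h' : (i : ℝ) ≤ 2 ^ j := by exact_mod_cast h
  unfold dyadicPt
  rw [Set.projIcc_of_mem zero_le_one
    (⟨by positivity, div_le_one_of_le₀ h' (by positivity)⟩ : (i : ℝ) / 2 ^ j ∈ Set.Icc (0 : ℝ) 1)]

theorem dyadicPt_succ_two_mul (j i : ℕ) : dyadicPt (j + 1) (2 * i) = dyadicPt j i := by
  unfold dyadicPt
  congr 1
  push_cast
  rw [pow_succ]
  field_simp

/-- The largest dyadic point of level `j` below `s`. -/
noncomputable def dyadicFloor (j : ℕ) (s : I) : I := dyadicPt j ⌊(s : ℝ) * 2 ^ j⌋₊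

theorem floor_mul_two_pow_le (j : ℕ) (s : I) : ⌊(s : ℝ) * 2 ^ j⌋₊ ≤ 2 ^ j := by
  refine Nat.floor_le_of_le ?_
  push_cast
  exact mul_le_of_le_one_left (by positivity) s.2.2

theorem tendsto_dyadicFloor (s : I) : Tendsto (fun j => dyadicFloor j s) atTop (𝓝 s) := by
  rw [tendsto_subtype_rng]
  have h0 : Tendsto (fun j : ℕ => (1 / 2 : ℝ) ^ j) atTop (𝓝 0) :=
    tendsto_pow_atTop_nhds_zero_of_lt_one (by norm_num) (by norm_num)
  refine tendsto_of_tendsto_of_tendsto_of_le_of_le (g := fun j : ℕ => (s : ℝ) - (1 / 2) ^ j)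
    (h := fun _ => (s : ℝ)) (by simpa using tendsto_const_nhds.sub h0) tendsto_const_nhds ?_ ?_
  · intro j
    have h1 := Nat.lt_floor_add_one ((s : ℝ) * 2 ^ j)
    have h2 : (0 : ℝ) < 2 ^ j := by positivity
    simp only [dyadicFloor, coe_dyadicPt (floor_mul_two_pow_le j s)]
    rw [one_div, inv_pow, le_div_iff₀ h2, sub_mul, inv_mul_cancel₀ h2.ne']
    linarith
  · intro j
    have h2 : (0 : ℝ) < 2 ^ j := by positivity
    simp only [dyadicFloor, coe_dyadicPt (floor_mul_two_pow_le j s)]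
    rw [div_le_iff₀ h2]
    exact Nat.floor_le (mul_nonneg s.2.1 h2.le)

/-- The constant in the one-parameter chaining bound `abs_sub_le_of_dyadic`. -/
noncomputable def chainConst (α : ℝ) : ℝ :=
  2 ^ α * (1 + 2 / (1 - (2 : ℝ) ^ (-α)))

theorem two_rpow_neg_lt_one {α : ℝ} (hα : 0 < α) : (2 : ℝ) ^ (-α) < 1 :=
  Real.rpow_lt_one_of_one_lt_of_neg one_lt_two (by linarith)

theorem chainConst_pos {α : ℝ} (hα : 0 < α) : 0 < chainConst α := by
  have := two_rpow_neg_lt_one hα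
  have : 0 < 1 - (2 : ℝ) ^ (-α) := by linarith
  unfold chainConst
  positivity

section OneParameter

variable {α M : ℝ} {g : I → ℝ}

theorem abs_sub_dyadicFloor_succ_le (hM : 0 ≤ M)
    (h : ∀ j i, i < 2 ^ j → |g (dyadicPt j (i + 1)) - g (dyadicPt j i)| ≤ M * ((2 : ℝ) ^ (-α)) ^ j)
    (j : ℕ) (s : I) :
    |g (dyadicFloor (j + 1) s) - g (dyadicFloor j s)| ≤ M * ((2 : ℝ) ^ (-α)) ^ (j + 1) := by
  have hb := floor_mul_two_pow_le (j + 1) s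
  have hx : 0 ≤ (s : ℝ) * 2 ^ j := mul_nonneg s.2.1 (by positivity)
  have hab : ⌊(s : ℝ) * 2 ^ (j + 1)⌋₊ = 2 * ⌊(s : ℝ) * 2 ^ j⌋₊ ∨
      ⌊(s : ℝ) * 2 ^ (j + 1)⌋₊ = 2 * ⌊(s : ℝ) * 2 ^ j⌋₊ + 1 := by
    have e : (s : ℝ) * 2 ^ (j + 1) = 2 * (s * 2 ^ j) := by ring
    rw [e]
    have h1 := Nat.floor_le hx
    have h2 := Nat.lt_floor_add_one ((s : ℝ) * 2 ^ j)
    have h3 := Nat.floor_le (mul_nonneg zero_le_two hx)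
    have h4 := Nat.lt_floor_add_one (2 * ((s : ℝ) * 2 ^ j))
    generalize ⌊(s : ℝ) * 2 ^ j⌋₊ = a at *
    generalize ⌊2 * ((s : ℝ) * 2 ^ j)⌋₊ = b at *
    have h5 : (b : ℝ) < (2 * a + 2 : ℕ) := by push_cast; linarith
    have h6 : ((2 * a : ℕ) : ℝ) < (b + 1 : ℕ) := by push_cast; linarith
    have h5' := Nat.cast_lt.1 h5
    have h6' := Nat.cast_lt.1 h6
    omega
  have hpos : 0 ≤ M * ((2 : ℝ) ^ (-α)) ^ (j + 1) := by positivity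
  unfold dyadicFloor
  rw [← dyadicPt_succ_two_mul j]
  rcases hab with e | e
  · rw [e, sub_self, abs_zero]
    exact hpos
  · rw [e] at hb ⊢
    exact h (j + 1) _ (by omega)

theorem abs_sub_dyadicFloor_le (hα : 0 < α) (hM : 0 ≤ M) (hg : Continuous g)
    (h : ∀ j i, i < 2 ^ j → |g (dyadicPt j (i + 1)) - g (dyadicPt j i)| ≤ M * ((2 : ℝ) ^ (-α)) ^ j)
    (j : ℕ) (s : I) :
    |g (dyadicFloor j s) - g s| ≤ M * ((2 : ℝ) ^ (-α)) ^ j / (1 - (2 : ℝ) ^ (-α)) := by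
  have hr := two_rpow_neg_lt_one hα
  have hr0 : (0 : ℝ) ≤ (2 : ℝ) ^ (-α) := by positivity
  have hlim : Tendsto (fun n => g (dyadicFloor (n + j) s)) atTop (𝓝 (g s)) :=
    (hg.tendsto s).comp ((tendsto_add_atTop_iff_nat j).2 (tendsto_dyadicFloor s))
  have := dist_le_of_le_geometric_of_tendsto₀ ((2 : ℝ) ^ (-α)) (M * ((2 : ℝ) ^ (-α)) ^ j) hr
    (f := fun n => g (dyadicFloor (n + j) s)) (fun n => ?_) hlim
  · simpa [Real.dist_eq] using this
  · rw [dist_comm, Real.dist_eq, add_right_comm]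
    refine (abs_sub_dyadicFloor_succ_le hM h (n + j) s).trans ?_
    rw [mul_assoc, ← pow_add, add_comm j n]
    exact mul_le_mul_of_nonneg_left (pow_le_pow_of_le_one hr0 hr.le (Nat.le_succ _)) hM

/-- Kolmogorov's chaining bound: a continuous function whose dyadic increments of level `j` are
at most `M 2 ^ (-α j)` is `α`-Hölder, with constant proportional to `M`. Both points are compared
with their dyadic floors at the level matching their distance. -/
theorem abs_sub_le_of_dyadic (hα : 0 < α) (hM : 0 ≤ M) (hg : Continuous g)
    (h : ∀ j i, i < 2 ^ j → |g (dyadicPt j (i + 1)) - g (dyadicPt j i)| ≤ M * ((2 : ℝ) ^ (-α)) ^ j)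
    (s t : I) : |g t - g s| ≤ chainConst α * M * |(t : ℝ) - s| ^ α := by
  wlog hst : s ≤ t generalizing s t
  · rw [abs_sub_comm (g t), abs_sub_comm (t : ℝ)]
    exact this t s (le_of_not_ge hst)
  rcases hst.eq_or_lt with rfl | hlt
  · simp [Real.zero_rpow hα.ne']
  have hlt' : (s : ℝ) < t := hlt
  set d : ℝ := t - s with hd
  have hd0 : 0 < d := by linarith
  have hd1 : d ≤ 1 := by linarith [s.2.1, t.2.2]
  obtain ⟨j, hj1, hj2⟩ := exists_nat_pow_near_of_lt_one hd0 hd1 (y := (1 / 2 : ℝ)) (by norm_num)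
    (by norm_num)
  have hr := two_rpow_neg_lt_one hα
  have hr0 : (0 : ℝ) < (2 : ℝ) ^ (-α) := by positivity
  set r := (2 : ℝ) ^ (-α) with hrdef
  have hrj : r ^ j ≤ 2 ^ α * d ^ α := by
    have e : r ^ j = 2 ^ α * ((1 / 2 : ℝ) ^ (j + 1)) ^ α := by
      rw [hrdef, ← Real.rpow_natCast ((2 : ℝ) ^ (-α)) j, ← Real.rpow_mul zero_le_two,
        ← Real.mul_rpow zero_le_two (by positivity), pow_succ, one_div, inv_pow]
      rw [show (2 : ℝ) * (((2 : ℝ) ^ j)⁻¹ * 2⁻¹) = ((2 : ℝ) ^ j)⁻¹ by ring, ← Real.rpow_natCast 2 j,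
        ← Real.rpow_neg zero_le_two, ← Real.rpow_mul zero_le_two]
      congr 1
      ring
    rw [e]
    gcongr
  have hmid : |g (dyadicFloor j t) - g (dyadicFloor j s)| ≤ M * r ^ j := by
    have hb := floor_mul_two_pow_le j t
    have hle : ⌊(s : ℝ) * 2 ^ j⌋₊ ≤ ⌊(t : ℝ) * 2 ^ j⌋₊ := Nat.floor_le_floor (by gcongr)
    have hle' : ⌊(t : ℝ) * 2 ^ j⌋₊ ≤ ⌊(s : ℝ) * 2 ^ j⌋₊ + 1 := by
      rw [← Nat.floor_add_one (mul_nonneg s.2.1 (by positivity))]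
      refine Nat.floor_le_floor ?_
      have : d * 2 ^ j ≤ 1 := by
        calc d * 2 ^ j ≤ (1 / 2) ^ j * 2 ^ j := by gcongr
          _ = 1 := by rw [← mul_pow]; norm_num
      rw [hd, sub_mul] at this
      linarith
    unfold dyadicFloor
    rcases (show ⌊(t : ℝ) * 2 ^ j⌋₊ = ⌊(s : ℝ) * 2 ^ j⌋₊ ∨
      ⌊(t : ℝ) * 2 ^ j⌋₊ = ⌊(s : ℝ) * 2 ^ j⌋₊ + 1 by omega) with e | e
    · rw [e, sub_self, abs_zero]
      positivity
    · rw [e] at hb ⊢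
      exact h j _ (by omega)
  have h1 := abs_sub_dyadicFloor_le hα hM hg h j s
  have h2 := abs_sub_dyadicFloor_le hα hM hg h j t
  rw [← hrdef] at h1 h2
  rw [abs_of_pos hd0]
  have h1r : 0 < 1 - r := by linarith
  calc |g t - g s| ≤ |g (dyadicFloor j t) - g t| + |g (dyadicFloor j t) - g (dyadicFloor j s)|
        + |g (dyadicFloor j s) - g s| := by
        rw [abs_sub_comm _ (g t)]
        have := abs_add_le (g t - g (dyadicFloor j t) + (g (dyadicFloor j t) - g (dyadicFloor j s)))
          (g (dyadicFloor j s) - g s)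
        have := abs_add_le (g t - g (dyadicFloor j t)) (g (dyadicFloor j t) - g (dyadicFloor j s))
        have e : g t - g s = g t - g (dyadicFloor j t) + (g (dyadicFloor j t) - g (dyadicFloor j s))
          + (g (dyadicFloor j s) - g s) := by ring
        rw [e]
        linarith
    _ ≤ M * r ^ j / (1 - r) + M * r ^ j + M * r ^ j / (1 - r) := by gcongr
    _ = (1 + 2 / (1 - r)) * M * r ^ j := by ring
    _ ≤ (1 + 2 / (1 - r)) * M * (2 ^ α * d ^ α) := by gcongr
    _ = chainConst α * M * d ^ α := by rw [chainConst, ← hrdef]; ring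

end OneParameter

/-- The increment of `f` over the dyadic rectangle of levels `j, k` and position `i, l`. -/
noncomputable def dyadicIncr (f : I → I → ℝ) (j k i l : ℕ) : ℝ :=
  planarIncr f (dyadicPt j i) (dyadicPt j (i + 1)) (dyadicPt k l) (dyadicPt k (l + 1))

/-- The planar chaining bound, from two applications of the one-parameter bound: one to each
increment of `f` in the second variable over a dyadic interval, and one to each increment of `f`
in the first variable. -/
theorem abs_planarIncr_le_of_dyadic {α β M : ℝ} (hα : 0 < α) (hβ : 0 < β) (hM : 0 ≤ M)
    {f : I → I → ℝ} (hf : Continuous fun z : I × I => f z.1 z.2)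
    (h : ∀ j k i l, i < 2 ^ j → l < 2 ^ k →
      |dyadicIncr f j k i l| ≤ M * ((2 : ℝ) ^ (-α)) ^ j * ((2 : ℝ) ^ (-β)) ^ k)
    (s₁ s₂ t₁ t₂ : I) :
    |planarIncr f s₁ s₂ t₁ t₂|
      ≤ chainConst α * chainConst β * M * |(s₂ : ℝ) - s₁| ^ α * |(t₂ : ℝ) - t₁| ^ β := by
  have hs : ∀ t, Continuous fun s => f s t := fun t =>
    hf.comp (Continuous.prodMk continuous_id continuous_const)
  have ht : ∀ s, Continuous fun t => f s t := fun s =>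
    hf.comp (Continuous.prodMk continuous_const continuous_id)
  have hCα := chainConst_pos hα
  have h1 : ∀ k l, l < 2 ^ k → |planarIncr f s₁ s₂ (dyadicPt k l) (dyadicPt k (l + 1))|
      ≤ chainConst α * (M * ((2 : ℝ) ^ (-β)) ^ k) * |(s₂ : ℝ) - s₁| ^ α := by
    intro k l hl
    have := abs_sub_le_of_dyadic (g := fun s => f s (dyadicPt k (l + 1)) - f s (dyadicPt k l))
      hα (M := M * ((2 : ℝ) ^ (-β)) ^ k) (by positivity) ((hs _).sub (hs _))
      (fun j i hi => ?_) s₁ s₂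
    · convert this using 2
      unfold planarIncr
      ring
    · convert h j k i l hi hl using 1
      · unfold dyadicIncr planarIncr
        congr 1
        ring
      · ring
  have := abs_sub_le_of_dyadic (g := fun t => f s₂ t - f s₁ t) hβ
    (M := chainConst α * M * |(s₂ : ℝ) - s₁| ^ α) (by positivity) ((ht _).sub (ht _))
    (fun k l hl => ?_) t₁ t₂
  · convert this using 1
    · unfold planarIncr
      congr 1
      ring
    · ring
  · convert h1 k l hl using 1
    · unfold planarIncr
      congr 1
      ring
    · ring

/-! ### Gaussian moments with a quadratic exponential weight -/

/-- The weight `z ^ (2 m) exp (lam z²)`. At `lam = 0` it is an even power; for `lam > 0` it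
dominates `exp (lam z²)` away from the origin while being of order `2 m` in the scale of `z`. -/
noncomputable def expMoment (m : ℕ) (lam z : ℝ) : ℝ := z ^ (2 * m) * Real.exp (lam * z ^ 2)

theorem expMoment_nonneg (m : ℕ) (lam z : ℝ) : 0 ≤ expMoment m lam z :=
  mul_nonneg (Even.pow_nonneg (even_two_mul m) z) (Real.exp_pos _).le

theorem measurable_expMoment (m : ℕ) (lam : ℝ) : Measurable (expMoment m lam) := by
  unfold expMoment
  fun_prop

/-- The moment `E[G ^ (2 m) exp (G² / 4)]` of a standard Gaussian variable `G`. -/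
noncomputable def gaussMoment (m : ℕ) : ℝ≥0∞ :=
  ∫⁻ g, ENNReal.ofReal (expMoment m (1 / 4) g) ∂(gaussianReal 0 1)

theorem gaussMoment_lt_top (m : ℕ) : gaussMoment m < ⊤ := by
  have h : Integrable (expMoment m (1 / 4)) (gaussianReal 0 1) := by
    rw [gaussianReal_of_var_ne_zero 0 one_ne_zero,
      integrable_withDensity_iff (measurable_gaussianPDF 0 1)
        (Eventually.of_forall fun _ => gaussianPDF_lt_top)]
    have h1 := (integrable_rpow_mul_exp_neg_mul_sq (b := 1 / 4) (by norm_num)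
      (s := ((2 * m : ℕ) : ℝ)) (by have : (0 : ℝ) ≤ ((2 * m : ℕ) : ℝ) := by positivity
                                   linarith)).const_mul (√(2 * Real.pi))⁻¹
    refine h1.congr (Eventually.of_forall fun z => ?_)
    simp only [toReal_gaussianPDF, gaussianPDFReal_def, expMoment, Real.rpow_natCast]
    have e : Real.exp (-(1 / 4) * z ^ 2)
        = Real.exp (1 / 4 * z ^ 2) * Real.exp (-(z - 0) ^ 2 / (2 * ((1 : NNReal) : ℝ))) := by
      rw [← Real.exp_add]
      congr 1
      push_cast
      ring
    rw [e]
    simp only [NNReal.coe_one, mul_one]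
    ring
  simpa [gaussMoment] using! h.lintegral_lt_top

theorem lintegral_expMoment_le {Ω : Type*} [MeasurableSpace Ω] {P : Measure Ω} {X : Ω → ℝ}
    {v : NNReal} (hX : HasLaw X (gaussianReal 0 v) P) {m : ℕ} {lam c B : ℝ} (hl : 0 ≤ lam)
    (hB : c ^ 2 * v ≤ B) (hlB : lam * B ≤ 1 / 4) :
    ∫⁻ ω, ENNReal.ofReal (expMoment m lam (c * X ω)) ∂P
      ≤ ENNReal.ofReal (B ^ m) * gaussMoment m := by
  have hmeas : Measurable fun z => ENNReal.ofReal (expMoment m lam (c * z)) :=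
    ((measurable_expMoment m lam).comp (measurable_const_mul c)).ennreal_ofReal
  have e1 : ∫⁻ ω, ENNReal.ofReal (expMoment m lam (c * X ω)) ∂P
      = ∫⁻ z, ENNReal.ofReal (expMoment m lam (c * z)) ∂(gaussianReal 0 v) := by
    rw [← hX.map_eq, lintegral_map' hmeas.aemeasurable hX.aemeasurable]
  have e2 : gaussianReal 0 v = (gaussianReal 0 1).map (√(v : ℝ) * ·) := by
    rw [gaussianReal_map_const_mul]
    congr 1
    · simp
    · ext
      simp
  rw [e1, e2, lintegral_map hmeas (measurable_const_mul _), gaussMoment,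
    ← lintegral_const_mul _ (measurable_expMoment m _).ennreal_ofReal]
  refine lintegral_mono fun g => ?_
  have hB0 : 0 ≤ B := le_trans (by positivity) hB
  rw [← ENNReal.ofReal_mul (by positivity)]
  refine ENNReal.ofReal_le_ofReal ?_
  have hsq : (c * (√(v : ℝ) * g)) ^ 2 = (c ^ 2 * v) * g ^ 2 := by
    rw [mul_pow, mul_pow, Real.sq_sqrt v.coe_nonneg]
    ring
  unfold expMoment
  rw [pow_mul, hsq, mul_pow, ← pow_mul g]
  calc (c ^ 2 * (v : ℝ)) ^ m * g ^ (2 * m) * Real.exp (lam * (c ^ 2 * v * g ^ 2))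
      ≤ B ^ m * g ^ (2 * m) * Real.exp (1 / 4 * g ^ 2) := by
        have h0 : 0 ≤ g ^ (2 * m) := Even.pow_nonneg (even_two_mul m) g
        have h1 : lam * (c ^ 2 * v * g ^ 2) ≤ 1 / 4 * g ^ 2 := by
          rw [← mul_assoc]
          refine mul_le_mul_of_nonneg_right ?_ (sq_nonneg g)
          exact (mul_le_mul_of_nonneg_left hB hl).trans hlB
        gcongr
    _ = B ^ m * (g ^ (2 * m) * Real.exp (1 / 4 * g ^ 2)) := by ring

/-! ### The dyadic functional and the bounds it gives along a path -/

/-- The sum over all dyadic rectangles of `expMoment m lam` of the increments of `f`, rescaled by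
the side lengths to the powers `-α` and `-β`. -/
noncomputable def dyadicSum (α β : ℝ) (m : ℕ) (lam : ℝ) (f : I → I → ℝ) : ℝ≥0∞ :=
  ∑' j : ℕ, ∑' k : ℕ, ∑ i ∈ Finset.range (2 ^ j), ∑ l ∈ Finset.range (2 ^ k),
    ENNReal.ofReal (expMoment m lam
      ((((2 : ℝ) ^ α) ^ j * ((2 : ℝ) ^ β) ^ k) * dyadicIncr f j k i l))

section Path

variable {α β : ℝ} {m : ℕ} {lam : ℝ} {f : I → I → ℝ}

theorem expMoment_le_dyadicSum {j k i l : ℕ} (hi : i < 2 ^ j) (hl : l < 2 ^ k) :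
    ENNReal.ofReal (expMoment m lam
      ((((2 : ℝ) ^ α) ^ j * ((2 : ℝ) ^ β) ^ k) * dyadicIncr f j k i l))
      ≤ dyadicSum α β m lam f := by
  unfold dyadicSum
  refine le_trans ?_ (ENNReal.le_tsum j)
  refine le_trans ?_ (ENNReal.le_tsum k)
  refine le_trans ?_ (Finset.single_le_sum (fun _ _ => zero_le) (Finset.mem_range.2 hi))
  exact Finset.single_le_sum (f := fun l => ENNReal.ofReal (expMoment m lam
    ((((2 : ℝ) ^ α) ^ j * ((2 : ℝ) ^ β) ^ k) * dyadicIncr f j k i l)))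
    (fun _ _ => zero_le) (Finset.mem_range.2 hl)

/-- A uniform bound on the rescaled dyadic increments bounds all rectangular increments. -/
theorem abs_planarIncr_le_of_scaled (hα : 0 < α) (hβ : 0 < β)
    (hf : Continuous fun z : I × I => f z.1 z.2) {M : ℝ} (hM : 0 ≤ M)
    (h : ∀ j k i l, i < 2 ^ j → l < 2 ^ k →
      |(((2 : ℝ) ^ α) ^ j * ((2 : ℝ) ^ β) ^ k) * dyadicIncr f j k i l| ≤ M)
    (s₁ s₂ t₁ t₂ : I) :
    |planarIncr f s₁ s₂ t₁ t₂|
      ≤ chainConst α * chainConst β * M * |(s₂ : ℝ) - s₁| ^ α * |(t₂ : ℝ) - t₁| ^ β := by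
  refine abs_planarIncr_le_of_dyadic hα hβ hM hf (fun j k i l hi hl => ?_) s₁ s₂ t₁ t₂
  have := h j k i l hi hl
  have hp : 0 < ((2 : ℝ) ^ α) ^ j * ((2 : ℝ) ^ β) ^ k := by positivity
  rw [abs_mul, abs_of_pos hp, ← le_div_iff₀' hp] at this
  refine this.trans_eq ?_
  rw [Real.rpow_neg zero_le_two, Real.rpow_neg zero_le_two, inv_pow, inv_pow, div_eq_mul_inv,
    mul_inv, mul_assoc]

theorem planarHolder_le_of_forall {K : ℝ}
    (h : ∀ s₁ s₂ t₁ t₂ : I, |planarIncr f s₁ s₂ t₁ t₂|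
      ≤ K * |(s₂ : ℝ) - s₁| ^ α * |(t₂ : ℝ) - t₁| ^ β) :
    planarHolder α β f ≤ ENNReal.ofReal K := by
  unfold planarHolder
  refine iSup_le fun s₁ => iSup_le fun s₂ => iSup_le fun t₁ => iSup_le fun t₂ => iSup_le fun hs =>
    iSup_le fun ht => ENNReal.ofReal_le_ofReal ?_
  have hs' : 0 < |(s₂ : ℝ) - s₁| := abs_pos.2 (sub_ne_zero.2 fun e => hs (Subtype.ext e.symm))
  have ht' : 0 < |(t₂ : ℝ) - t₁| := abs_pos.2 (sub_ne_zero.2 fun e => ht (Subtype.ext e.symm))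
  rw [div_le_iff₀ (by positivity), ← mul_assoc]
  exact h s₁ s₂ t₁ t₂

theorem planarHolder_le_dyadicSum (hα : 0 < α) (hβ : 0 < β) (hm : m ≠ 0)
    (hf : Continuous fun z : I × I => f z.1 z.2) :
    planarHolder α β f ≤ ENNReal.ofReal (chainConst α * chainConst β)
      * dyadicSum α β m 0 f ^ (1 / ((2 * m : ℕ) : ℝ)) := by
  have hCα := chainConst_pos hα
  have hCβ := chainConst_pos hβ
  have hm' : (0 : ℝ) < ((2 * m : ℕ) : ℝ) := by positivity
  rcases eq_or_ne (dyadicSum α β m 0 f) ⊤ with htop | hfin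
  · rw [htop, ENNReal.top_rpow_of_pos (by positivity), ENNReal.mul_top]
    · exact le_top
    · simpa using mul_pos hCα hCβ
  set S := (dyadicSum α β m 0 f).toReal with hS
  have hS0 : 0 ≤ S := ENNReal.toReal_nonneg
  have key := planarHolder_le_of_forall (abs_planarIncr_le_of_scaled hα hβ hf
    (M := S ^ (1 / ((2 * m : ℕ) : ℝ))) (by positivity) fun j k i l hi hl => ?_)
  · refine key.trans_eq ?_
    rw [ENNReal.ofReal_mul (by positivity), hS, ENNReal.toReal_rpow,
      ENNReal.ofReal_toReal (ENNReal.rpow_ne_top_of_nonneg (by positivity) hfin)]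
  · have h1 := (ENNReal.ofReal_le_iff_le_toReal hfin).1
      (expMoment_le_dyadicSum (α := α) (β := β) (m := m) (lam := 0) (f := f) hi hl)
    generalize (((2 : ℝ) ^ α) ^ j * ((2 : ℝ) ^ β) ^ k) * dyadicIncr f j k i l = z at h1 ⊢
    simp only [expMoment, zero_mul, Real.exp_zero, mul_one] at h1
    rw [one_div, Real.le_rpow_inv_iff_of_pos (abs_nonneg z) hS0 hm', Real.rpow_natCast,
      (even_two_mul m).pow_abs]
    exact h1

/-- The exponential is at most `e` where `lam z² ≤ 1`, and at most `lam ^ m` times the weight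
elsewhere. -/
theorem exp_le_expMoment (hl : 0 < lam) (z : ℝ) :
    Real.exp (lam * z ^ 2) ≤ Real.exp 1 + lam ^ m * expMoment m lam z := by
  rcases le_total (lam * z ^ 2) 1 with h | h
  · have := Real.exp_le_exp.2 h
    have := mul_nonneg (pow_nonneg hl.le m) (expMoment_nonneg m lam z)
    linarith
  · have h1 : Real.exp (lam * z ^ 2) ≤ (lam * z ^ 2) ^ m * Real.exp (lam * z ^ 2) :=
      le_mul_of_one_le_left (Real.exp_pos _).le (one_le_pow₀ h)
    have e : (lam * z ^ 2) ^ m * Real.exp (lam * z ^ 2) = lam ^ m * expMoment m lam z := by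
      rw [expMoment, mul_pow, ← pow_mul, mul_assoc]
    have := Real.exp_pos 1
    linarith

theorem exp_iSup_sq_le_dyadicSum (hα : 0 < α) (hβ : 0 < β) (hl : 0 < lam)
    (hf : Continuous fun z : I × I => f z.1 z.2) (hf₁ : ∀ t, f 0 t = 0) (hf₂ : ∀ s, f s 0 = 0) :
    ENNReal.ofReal (Real.exp (lam / (chainConst α * chainConst β) ^ 2
        * ⨆ z : I × I, |f z.1 z.2| ^ 2))
      ≤ ENNReal.ofReal (Real.exp 1) + ENNReal.ofReal (lam ^ m) * dyadicSum α β m lam f := by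
  have hCα := chainConst_pos hα
  have hCβ := chainConst_pos hβ
  rcases eq_or_ne (dyadicSum α β m lam f) ⊤ with htop | hfin
  · rw [htop, ENNReal.mul_top]
    · simp
    · simpa using pow_pos hl m
  set S := (dyadicSum α β m lam f).toReal with hS
  have hS0 : 0 ≤ S := ENNReal.toReal_nonneg
  set T := Real.exp 1 + lam ^ m * S with hT
  have hTpos : 0 < T := by positivity
  have hT1 : 1 ≤ T := by
    have : (1 : ℝ) ≤ Real.exp 1 := Real.one_le_exp zero_le_one
    have : 0 ≤ lam ^ m * S := by positivity
    linarith
  have hlog : 0 ≤ Real.log T / lam := div_nonneg (Real.log_nonneg hT1) hl.le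
  have key := abs_planarIncr_le_of_scaled hα hβ hf (M := √(Real.log T / lam)) (by positivity)
    fun j k i l hi hl' => ?_
  · have hsup : ⨆ z : I × I, |f z.1 z.2| ^ 2
        ≤ (chainConst α * chainConst β) ^ 2 * (Real.log T / lam) := by
      refine ciSup_le fun z => ?_
      have h1 := key 0 z.1 0 z.2
      have e : planarIncr f 0 z.1 0 z.2 = f z.1 z.2 := by simp [planarIncr, hf₁, hf₂]
      rw [e] at h1
      have hz1 : |(z.1 : ℝ) - (0 : I)| ^ α ≤ 1 := by
        refine Real.rpow_le_one (abs_nonneg _) ?_ hα.le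
        simpa [abs_of_nonneg z.1.2.1] using z.1.2.2
      have hz2 : |(z.2 : ℝ) - (0 : I)| ^ β ≤ 1 := by
        refine Real.rpow_le_one (abs_nonneg _) ?_ hβ.le
        simpa [abs_of_nonneg z.2.2.1] using z.2.2.2
      have h2 : |f z.1 z.2| ≤ chainConst α * chainConst β * √(Real.log T / lam) := by
        refine h1.trans ?_
        refine (mul_le_of_le_one_right (by positivity) hz2).trans ?_
        exact mul_le_of_le_one_right (by positivity) hz1
      calc |f z.1 z.2| ^ 2 ≤ (chainConst α * chainConst β * √(Real.log T / lam)) ^ 2 := by gcongr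
        _ = _ := by rw [mul_pow, Real.sq_sqrt hlog]
    have hTe : ENNReal.ofReal (Real.exp 1) + ENNReal.ofReal (lam ^ m) * dyadicSum α β m lam f
        = ENNReal.ofReal T := by
      rw [hT, ENNReal.ofReal_add (by positivity) (by positivity),
        ENNReal.ofReal_mul (by positivity), hS, ENNReal.ofReal_toReal hfin]
    rw [hTe]
    refine ENNReal.ofReal_le_ofReal ?_
    rw [← Real.le_log_iff_exp_le hTpos]
    calc lam / (chainConst α * chainConst β) ^ 2 * ⨆ z : I × I, |f z.1 z.2| ^ 2
        ≤ lam / (chainConst α * chainConst β) ^ 2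
          * ((chainConst α * chainConst β) ^ 2 * (Real.log T / lam)) := by gcongr
      _ = Real.log T := by field_simp
  · have h1 := (ENNReal.ofReal_le_iff_le_toReal hfin).1
      (expMoment_le_dyadicSum (α := α) (β := β) (m := m) (lam := lam) (f := f) hi hl')
    generalize (((2 : ℝ) ^ α) ^ j * ((2 : ℝ) ^ β) ^ k) * dyadicIncr f j k i l = z at h1 ⊢
    have h2 : Real.exp (lam * z ^ 2) ≤ T := by
      refine (exp_le_expMoment (m := m) hl z).trans ?_
      rw [hT]
      gcongr
    rw [← Real.sqrt_sq_eq_abs]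
    refine Real.sqrt_le_sqrt ?_
    rw [le_div_iff₀ hl, mul_comm, Real.le_log_iff_exp_le hTpos]
    exact h2

end Path

/-! ### Fields with Gaussian rectangular increments -/

/-- All rectangular increments of `y` are centered Gaussian, with variance at most
`A |s₂ - s₁| ^ (2 a) |t₂ - t₁| ^ (2 b)`. -/
def HasGaussianIncr {Ω : Type*} [MeasurableSpace Ω] (P : Measure Ω) (y : I → I → Ω → ℝ)
    (A a b : ℝ) : Prop :=
  ∀ s₁ s₂ t₁ t₂ : I, ∃ v : NNReal,
    HasLaw (fun ω => planarIncr (fun s t => y s t ω) s₁ s₂ t₁ t₂) (gaussianReal 0 v) P ∧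
      (v : ℝ) ≤ A * (|(s₂ : ℝ) - s₁| ^ (2 * a) * |(t₂ : ℝ) - t₁| ^ (2 * b))

section Field

variable {Ω : Type*} [MeasurableSpace Ω] {P : Measure Ω} {y : I → I → Ω → ℝ} {A a b : ℝ}

theorem HasGaussianIncr.aemeasurable_dyadicSum (hy : HasGaussianIncr P y A a b) (α β : ℝ) (m : ℕ)
    (lam : ℝ) : AEMeasurable (fun ω => dyadicSum α β m lam (fun s t => y s t ω)) P := by
  unfold dyadicSum
  refine AEMeasurable.tsum fun j => AEMeasurable.tsum fun k =>
    Finset.aemeasurable_fun_sum _ fun i _ => Finset.aemeasurable_fun_sum _ fun l _ => ?_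
  obtain ⟨v, hv, -⟩ := hy (dyadicPt j i) (dyadicPt j (i + 1)) (dyadicPt k l) (dyadicPt k (l + 1))
  exact ((measurable_expMoment m lam).comp_aemeasurable
    (hv.aemeasurable.const_mul _)).ennreal_ofReal

/-- The constant bounding the mean of `dyadicSum`; `a'` and `b'` are the losses of regularity in
the two variables. -/
noncomputable def chainMoment (m : ℕ) (a' b' : ℝ) : ℝ≥0∞ :=
  gaussMoment m * ((1 - ENNReal.ofReal (2 * ((2 : ℝ) ^ (-(2 * a'))) ^ m))⁻¹
    * (1 - ENNReal.ofReal (2 * ((2 : ℝ) ^ (-(2 * b'))) ^ m))⁻¹)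

theorem two_mul_pow_lt_one {a' : ℝ} {m : ℕ} (h : 1 < 2 * m * a') :
    2 * ((2 : ℝ) ^ (-(2 * a'))) ^ m < 1 := by
  rw [← Real.rpow_natCast, ← Real.rpow_mul zero_le_two]
  nth_rewrite 1 [← Real.rpow_one 2]
  rw [← Real.rpow_add two_pos]
  exact Real.rpow_lt_one_of_one_lt_of_neg one_lt_two (by linarith)

theorem chainMoment_lt_top {m : ℕ} {a' b' : ℝ} (ha : 1 < 2 * m * a') (hb : 1 < 2 * m * b') :
    chainMoment m a' b' < ⊤ := by
  have key : ∀ c : ℝ, 1 < 2 * m * c →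
      (1 - ENNReal.ofReal (2 * ((2 : ℝ) ^ (-(2 * c))) ^ m))⁻¹ < ⊤ := fun c hc => by
    rw [ENNReal.inv_lt_top, tsub_pos_iff_lt, ← ENNReal.ofReal_one]
    exact (ENNReal.ofReal_lt_ofReal_iff one_pos).2 (two_mul_pow_lt_one hc)
  exact ENNReal.mul_lt_top (gaussMoment_lt_top m) (ENNReal.mul_lt_top (key _ ha) (key _ hb))

theorem abs_dyadicPt_succ_sub {j i : ℕ} (hi : i < 2 ^ j) :
    |(dyadicPt j (i + 1) : ℝ) - dyadicPt j i| = ((2 : ℝ) ^ j)⁻¹ := by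
  rw [coe_dyadicPt hi, coe_dyadicPt hi.le, ← sub_div]
  push_cast
  rw [add_sub_cancel_left, one_div, abs_of_pos (by positivity)]

theorem scaled_variance (a α : ℝ) (j : ℕ) :
    (((2 : ℝ) ^ α) ^ j) ^ 2 * (((2 : ℝ) ^ j)⁻¹) ^ (2 * a) = ((2 : ℝ) ^ (-(2 * (a - α)))) ^ j := by
  rw [← Real.rpow_natCast ((2 : ℝ) ^ α), ← Real.rpow_natCast (2 : ℝ) j,
    ← Real.rpow_neg zero_le_two, ← Real.rpow_mul zero_le_two, ← Real.rpow_mul zero_le_two,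
    ← Real.rpow_natCast _ 2, ← Real.rpow_mul zero_le_two, ← Real.rpow_natCast _ j,
    ← Real.rpow_mul zero_le_two, ← Real.rpow_add two_pos]
  congr 1
  push_cast
  ring

theorem HasGaussianIncr.lintegral_dyadicSum_le (hy : HasGaussianIncr P y A a b) (hA : 0 ≤ A)
    {α β lam : ℝ} {m : ℕ} (hα : α < a) (hβ : β < b) (hl : 0 ≤ lam) (hlA : lam * A ≤ 1 / 4) :
    ∫⁻ ω, dyadicSum α β m lam (fun s t => y s t ω) ∂P
      ≤ ENNReal.ofReal (A ^ m) * chainMoment m (a - α) (b - β) := by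
  set ρ : ℝ := (2 : ℝ) ^ (-(2 * (a - α))) with hρ
  set τ : ℝ := (2 : ℝ) ^ (-(2 * (b - β))) with hτ
  have hρ0 : 0 < ρ := by positivity
  have hτ0 : 0 < τ := by positivity
  have hρ1 : ρ ≤ 1 := (two_rpow_neg_lt_one (by linarith)).le
  have hτ1 : τ ≤ 1 := (two_rpow_neg_lt_one (by linarith)).le
  have hterm : ∀ j k i l : ℕ, i < 2 ^ j → l < 2 ^ k →
      ∫⁻ ω, ENNReal.ofReal (expMoment m lam ((((2 : ℝ) ^ α) ^ j * ((2 : ℝ) ^ β) ^ k)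
        * dyadicIncr (fun s t => y s t ω) j k i l)) ∂P
      ≤ ENNReal.ofReal ((A * (ρ ^ j * τ ^ k)) ^ m) * gaussMoment m := by
    intro j k i l hi hl'
    obtain ⟨v, hv, hvA⟩ :=
      hy (dyadicPt j i) (dyadicPt j (i + 1)) (dyadicPt k l) (dyadicPt k (l + 1))
    refine lintegral_expMoment_le hv hl ?_ ?_
    · rw [abs_dyadicPt_succ_sub hi, abs_dyadicPt_succ_sub hl'] at hvA
      calc (((2 : ℝ) ^ α) ^ j * ((2 : ℝ) ^ β) ^ k) ^ 2 * (v : ℝ)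
          ≤ (((2 : ℝ) ^ α) ^ j * ((2 : ℝ) ^ β) ^ k) ^ 2
            * (A * ((((2 : ℝ) ^ j)⁻¹) ^ (2 * a) * (((2 : ℝ) ^ k)⁻¹) ^ (2 * b))) := by gcongr
        _ = A * (((((2 : ℝ) ^ α) ^ j) ^ 2 * (((2 : ℝ) ^ j)⁻¹) ^ (2 * a))
            * ((((2 : ℝ) ^ β) ^ k) ^ 2 * (((2 : ℝ) ^ k)⁻¹) ^ (2 * b))) := by ring
        _ = A * (ρ ^ j * τ ^ k) := by rw [scaled_variance, scaled_variance]
    · refine le_trans (mul_le_mul_of_nonneg_left ?_ hl) hlA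
      exact mul_le_of_le_one_right hA
        (mul_le_one₀ (pow_le_one₀ hρ0.le hρ1) (by positivity) (pow_le_one₀ hτ0.le hτ1))
  have hmeas : ∀ j k i l : ℕ, AEMeasurable (fun ω => ENNReal.ofReal (expMoment m lam
      ((((2 : ℝ) ^ α) ^ j * ((2 : ℝ) ^ β) ^ k)
        * dyadicIncr (fun s t => y s t ω) j k i l))) P := by
    intro j k i l
    obtain ⟨v, hv, -⟩ := hy (dyadicPt j i) (dyadicPt j (i + 1)) (dyadicPt k l) (dyadicPt k (l + 1))
    exact ((measurable_expMoment m lam).comp_aemeasurable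
      (hv.aemeasurable.const_mul _)).ennreal_ofReal
  unfold dyadicSum
  rw [lintegral_tsum fun j => AEMeasurable.tsum fun k =>
    Finset.aemeasurable_fun_sum _ fun i _ => Finset.aemeasurable_fun_sum _ fun l _ => hmeas j k i l]
  calc ∑' j : ℕ, ∫⁻ ω, ∑' k : ℕ, ∑ i ∈ Finset.range (2 ^ j), ∑ l ∈ Finset.range (2 ^ k),
        ENNReal.ofReal (expMoment m lam ((((2 : ℝ) ^ α) ^ j * ((2 : ℝ) ^ β) ^ k)
          * dyadicIncr (fun s t => y s t ω) j k i l)) ∂P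
      ≤ ∑' j : ℕ, ∑' k : ℕ, ENNReal.ofReal (A ^ m) * gaussMoment m
        * (ENNReal.ofReal (2 * ρ ^ m) ^ j * ENNReal.ofReal (2 * τ ^ m) ^ k) := by
        refine ENNReal.tsum_le_tsum fun j => ?_
        rw [lintegral_tsum fun k => Finset.aemeasurable_fun_sum _ fun i _ =>
          Finset.aemeasurable_fun_sum _ fun l _ => hmeas j k i l]
        refine ENNReal.tsum_le_tsum fun k => ?_
        rw [lintegral_finsetSum' _ fun i _ =>
          Finset.aemeasurable_fun_sum _ fun l _ => hmeas j k i l]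
        calc _ ≤ ∑ i ∈ Finset.range (2 ^ j), ∑ l ∈ Finset.range (2 ^ k),
              ENNReal.ofReal ((A * (ρ ^ j * τ ^ k)) ^ m) * gaussMoment m := by
              refine Finset.sum_le_sum fun i hi => ?_
              rw [lintegral_finsetSum' _ fun l _ => hmeas j k i l]
              exact Finset.sum_le_sum fun l hl' =>
                hterm j k i l (Finset.mem_range.1 hi) (Finset.mem_range.1 hl')
          _ = _ := by
              simp only [Finset.sum_const, Finset.card_range, nsmul_eq_mul]
              rw [← ENNReal.ofReal_pow (by positivity), ← ENNReal.ofReal_pow (by positivity),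
                ← ENNReal.ofReal_mul (by positivity), ← ENNReal.ofReal_natCast,
                ← ENNReal.ofReal_natCast, ← mul_assoc, ← mul_assoc,
                ← ENNReal.ofReal_mul (by positivity), ← ENNReal.ofReal_mul (by positivity),
                mul_right_comm _ (gaussMoment m), ← ENNReal.ofReal_mul (by positivity)]
              congr 2
              push_cast
              ring
    _ = ENNReal.ofReal (A ^ m) * chainMoment m (a - α) (b - β) := by
        simp only [ENNReal.tsum_mul_left, ENNReal.tsum_mul_right, ENNReal.tsum_geometric,
          chainMoment]
        rw [mul_assoc]

end Field

/-! ### The harmonizable kernel -/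

/-- The integral `∫ |exp (i ξ) - 1|² / |ξ| ^ (2 γ + 1) dξ`. -/
noncomputable def kernelMass (γ : ℝ) : ℝ := ∫ ξ : ℝ, ‖kernelOne γ 1 ξ‖ ^ 2

theorem kernelMass_nonneg (γ : ℝ) : 0 ≤ kernelMass γ := integral_nonneg fun _ => by positivity

theorem norm_kernelOne (γ s ξ : ℝ) :
    ‖kernelOne γ s ξ‖
      = ‖Complex.exp (Complex.I * ((s * ξ : ℝ) : ℂ)) - 1‖ / |ξ| ^ (γ + 1 / 2) := by
  rw [kernelOne, norm_div, Complex.norm_real, Real.norm_of_nonneg (by positivity)]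

theorem norm_kernelOne_sub (γ s₁ s₂ ξ : ℝ) :
    ‖kernelOne γ s₂ ξ - kernelOne γ s₁ ξ‖ = ‖kernelOne γ (s₂ - s₁) ξ‖ := by
  have e : kernelOne γ s₂ ξ - kernelOne γ s₁ ξ
      = Complex.exp (((s₁ * ξ : ℝ) : ℂ) * Complex.I) * kernelOne γ (s₂ - s₁) ξ := by
    unfold kernelOne
    rw [← sub_div, ← mul_div_assoc, mul_sub, ← Complex.exp_add]
    congr 1
    rw [mul_one, sub_sub_sub_cancel_right]
    congr 2
    · push_cast
      ring
    · ring
  rw [e, norm_mul, Complex.norm_exp_ofReal_mul_I, one_mul]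

theorem integral_norm_sq_kernelOne {γ : ℝ} (hγ : 0 < γ) (s : ℝ) :
    ∫ ξ : ℝ, ‖kernelOne γ s ξ‖ ^ 2 = |s| ^ (2 * γ) * kernelMass γ := by
  rcases eq_or_ne s 0 with rfl | hs
  · have : (2 * γ) ≠ 0 := by positivity
    simp [kernelOne, Real.zero_rpow this]
  have hs' : 0 < |s| := abs_pos.2 hs
  have e : ∀ ξ : ℝ, ‖kernelOne γ s ξ‖ ^ 2
      = |s| ^ (2 * γ + 1) * ‖kernelOne γ 1 (s * ξ)‖ ^ 2 := by
    intro ξ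
    have h2 : |s| ^ (2 * γ + 1) = (|s| ^ (γ + 1 / 2)) ^ 2 := by
      rw [← Real.rpow_natCast, ← Real.rpow_mul hs'.le]
      congr 1
      push_cast
      ring
    have h3 : |s| ^ (γ + 1 / 2) ≠ 0 := by positivity
    rw [norm_kernelOne, norm_kernelOne, h2, one_mul, abs_mul,
      Real.mul_rpow (abs_nonneg _) (abs_nonneg _), div_mul_eq_div_div_swap, div_pow _ (|s| ^ _),
      mul_div_cancel₀ _ (pow_ne_zero 2 h3)]
  simp_rw [e]
  rw [integral_const_mul, Measure.integral_comp_mul_left (fun ξ => ‖kernelOne γ 1 ξ‖ ^ 2) s,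
    smul_eq_mul, ← mul_assoc, abs_inv, Real.rpow_add_one hs'.ne', mul_assoc (|s| ^ _),
    mul_inv_cancel₀ hs'.ne', mul_one, kernelMass]

/-- Lowering the Hurst parameter by `δ` gains a factor `n ^ (-δ)` at frequencies above `n`. -/
theorem norm_kernelOne_le_of_lt {γ δ s ξ : ℝ} {n : ℕ} (hδ : 0 < δ) (hn : 0 < n) (hξ : n < |ξ|) :
    ‖kernelOne γ s ξ‖ ^ 2 ≤ ((n : ℝ) ^ (-δ)) ^ 2 * ‖kernelOne (γ - δ) s ξ‖ ^ 2 := by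
  have hn' : (0 : ℝ) < n := by exact_mod_cast hn
  have hξ' : 0 < |ξ| := hn'.trans hξ
  have e : ‖kernelOne γ s ξ‖ = |ξ| ^ (-δ) * ‖kernelOne (γ - δ) s ξ‖ := by
    rw [norm_kernelOne, norm_kernelOne, Real.rpow_neg hξ'.le, ← div_eq_inv_mul, div_div,
      ← Real.rpow_add hξ']
    congr 2
    ring
  rw [e, mul_pow]
  have := Real.rpow_le_rpow_of_nonpos hn' hξ.le (neg_nonpos.2 hδ.le)
  gcongr

theorem plane_integrable_and_integral_mul {u w : ℝ → ℝ} (hu : Integrable u) (hw : Integrable w) :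
    Integrable (fun z : Plane => u (z 0) * w (z 1)) ∧
      ∫ z : Plane, u (z 0) * w (z 1) = (∫ ξ, u ξ) * ∫ η, w η := by
  have hmp := PiLp.volume_preserving_ofLp (Fin 2)
  have hemb := (MeasurableEquiv.toLp 2 (Fin 2 → ℝ)).symm.measurableEmbedding
  constructor
  · have h : Integrable (fun x : Fin 2 → ℝ => ∏ i, (![u, w] i) (x i))
        (Measure.pi fun _ => volume) := by
      refine Integrable.fintype_prod (fun i => ?_)
      fin_cases i
      · exact hu
      · exact hw
    refine ((hmp.integrable_comp_emb hemb).2 h).congr (Eventually.of_forall fun z => ?_)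
    simp
  · have h := hmp.integral_comp hemb (fun x : Fin 2 → ℝ => ∏ i, (![u, w] i) (x i))
    rw [integral_fintype_prod_volume_eq_prod] at h
    simpa using! h

theorem norm_sq_le_integral_of_ae_le {E : Type*} [MeasurableSpace E] {μ : Measure E}
    (f : Lp ℂ 2 μ) {G : E → ℝ} (hG : Integrable G μ) (h : ∀ᵐ z ∂μ, ‖f z‖ ^ 2 ≤ G z) :
    ‖f‖ ^ 2 ≤ ∫ z, G z ∂μ := by
  have hint : Integrable (fun z => ‖f z‖ ^ 2) μ :=
    (memLp_two_iff_integrable_sq_norm (Lp.aestronglyMeasurable f)).1 (Lp.memLp f)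
  have e : ‖f‖ ^ 2 = ∫ z, ‖f z‖ ^ 2 ∂μ := by
    have h1 := inner_self_eq_norm_sq_to_K (𝕜 := ℂ) f
    rw [L2.inner_def] at h1
    simp_rw [inner_self_eq_norm_sq_to_K] at h1
    have h2 : ((∫ z, ‖f z‖ ^ 2 ∂μ : ℝ) : ℂ) = ((‖f‖ ^ 2 : ℝ) : ℂ) := by
      rw [← integral_complex_ofReal]
      simpa using! h1
    exact (Complex.ofReal_injective h2).symm
  rw [e]
  exact integral_mono_ae hint hG h

/-- The rectangular increment of a two-parameter family in an abelian group. -/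
def rectIncr {E : Type*} [AddCommGroup E] (φ : I → I → E) (s₁ s₂ t₁ t₂ : I) : E :=
  φ s₂ t₂ - φ s₂ t₁ - φ s₁ t₂ + φ s₁ t₁

section Kernel

variable {γ₁ γ₂ : ℝ} (h₁ : γ₁ ∈ Set.Ioo (0 : ℝ) 1) (h₂ : γ₂ ∈ Set.Ioo (0 : ℝ) 1)

theorem kernelQ_rectIncr (s₁ s₂ t₁ t₂ : ℝ) (z : Plane) :
    ‖kernelQ γ₁ γ₂ s₂ t₂ z - kernelQ γ₁ γ₂ s₂ t₁ z - kernelQ γ₁ γ₂ s₁ t₂ z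
        + kernelQ γ₁ γ₂ s₁ t₁ z‖ ^ 2
      = ‖kernelOne γ₁ (s₂ - s₁) (z 0)‖ ^ 2 * ‖kernelOne γ₂ (t₂ - t₁) (z 1)‖ ^ 2 := by
  rw [← norm_kernelOne_sub, ← norm_kernelOne_sub, ← mul_pow, ← norm_mul]
  unfold kernelQ
  congr 2
  ring

theorem coeFn_kernelLp (s t : ℝ) :
    kernelLp h₁ h₂ s t =ᵐ[volume] kernelQ γ₁ γ₂ s t :=
  MemLp.coeFn_toLp _

theorem coeFn_kernelCutLp (n : ℕ) (s t : ℝ) :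
    kernelCutLp h₁ h₂ n s t =ᵐ[volume] (cutoff n).indicator (kernelQ γ₁ γ₂ s t) :=
  MemLp.coeFn_toLp _

theorem norm_sq_rectIncr_kernelCutLp_le (n : ℕ) (s₁ s₂ t₁ t₂ : I) :
    ‖rectIncr (fun s t : I => kernelCutLp h₁ h₂ n s t) s₁ s₂ t₁ t₂‖ ^ 2
      ≤ (kernelMass γ₁ * kernelMass γ₂)
        * (|(s₂ : ℝ) - s₁| ^ (2 * γ₁) * |(t₂ : ℝ) - t₁| ^ (2 * γ₂)) := by
  obtain ⟨hint, hval⟩ := plane_integrable_and_integral_mul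
    (integrable_kernelOne h₁ ((s₂ : ℝ) - s₁)) (integrable_kernelOne h₂ ((t₂ : ℝ) - t₁))
  refine (norm_sq_le_integral_of_ae_le _ hint ?_).trans_eq ?_
  · unfold rectIncr
    filter_upwards [coeFn_kernelCutLp h₁ h₂ n s₂ t₂, coeFn_kernelCutLp h₁ h₂ n s₂ t₁,
      coeFn_kernelCutLp h₁ h₂ n s₁ t₂, coeFn_kernelCutLp h₁ h₂ n s₁ t₁,
      Lp.coeFn_sub (kernelCutLp h₁ h₂ n s₂ t₂) (kernelCutLp h₁ h₂ n s₂ t₁),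
      Lp.coeFn_sub (kernelCutLp h₁ h₂ n s₂ t₂ - kernelCutLp h₁ h₂ n s₂ t₁)
        (kernelCutLp h₁ h₂ n s₁ t₂),
      Lp.coeFn_add (kernelCutLp h₁ h₂ n s₂ t₂ - kernelCutLp h₁ h₂ n s₂ t₁
        - kernelCutLp h₁ h₂ n s₁ t₂) (kernelCutLp h₁ h₂ n s₁ t₁)]
      with z e1 e2 e3 e4 e5 e6 e7
    rw [e7, Pi.add_apply, e6, Pi.sub_apply, e5, Pi.sub_apply, e1, e2, e3, e4]
    by_cases hz : z ∈ cutoff n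
    · simp only [Set.indicator_of_mem hz]
      exact (kernelQ_rectIncr _ _ _ _ z).le
    · simp only [Set.indicator_of_notMem hz, sub_self, add_zero, norm_zero, zero_pow two_ne_zero]
      positivity
  · rw [hval, integral_norm_sq_kernelOne h₁.1, integral_norm_sq_kernelOne h₂.1]
    ring

theorem rpow_two_mul_le_of_sub {γ δ d : ℝ} (hδ : 0 < δ) (hδγ : δ < γ) (hd0 : 0 ≤ d) (hd1 : d ≤ 1) :
    d ^ (2 * γ) ≤ d ^ (2 * (γ - δ)) := by
  rcases hd0.eq_or_lt with rfl | hd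
  · rw [Real.zero_rpow (by linarith), Real.zero_rpow (by linarith)]
  · exact Real.rpow_le_rpow_of_exponent_ge hd hd1 (by linarith)

theorem abs_sub_le_one (s t : I) : |(s : ℝ) - t| ≤ 1 :=
  abs_le.2 ⟨by linarith [s.2.1, t.2.2], by linarith [s.2.2, t.2.1]⟩

theorem norm_sq_rectIncr_cut_sub_le {δ : ℝ} (hδ : 0 < δ) (hδ₁ : δ < γ₁) (hδ₂ : δ < γ₂) {n : ℕ}
    (hn : 0 < n) (s₁ s₂ t₁ t₂ : I) :
    ‖rectIncr (fun s t : I => kernelCutLp h₁ h₂ n s t - kernelLp h₁ h₂ s t) s₁ s₂ t₁ t₂‖ ^ 2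
      ≤ (((n : ℝ) ^ (-δ)) ^ 2 * (kernelMass (γ₁ - δ) * kernelMass γ₂
          + kernelMass γ₁ * kernelMass (γ₂ - δ)))
        * (|(s₂ : ℝ) - s₁| ^ (2 * (γ₁ - δ)) * |(t₂ : ℝ) - t₁| ^ (2 * (γ₂ - δ))) := by
  have h₁' : γ₁ - δ ∈ Set.Ioo (0 : ℝ) 1 := ⟨by linarith, by linarith [h₁.2]⟩
  have h₂' : γ₂ - δ ∈ Set.Ioo (0 : ℝ) 1 := ⟨by linarith, by linarith [h₂.2]⟩
  obtain ⟨hint, hval⟩ := plane_integrable_and_integral_mul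
    (integrable_kernelOne h₁' ((s₂ : ℝ) - s₁)) (integrable_kernelOne h₂ ((t₂ : ℝ) - t₁))
  obtain ⟨hint', hval'⟩ := plane_integrable_and_integral_mul
    (integrable_kernelOne h₁ ((s₂ : ℝ) - s₁)) (integrable_kernelOne h₂' ((t₂ : ℝ) - t₁))
  refine (norm_sq_le_integral_of_ae_le _ ((hint.add hint').const_mul (((n : ℝ) ^ (-δ)) ^ 2))
    ?_).trans ?_
  · unfold rectIncr
    set F := fun s t : I => kernelCutLp h₁ h₂ n s t - kernelLp h₁ h₂ s t with hF
    have hFz : ∀ s t : I, ∀ᵐ z, F s t z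
        = (cutoff n).indicator (kernelQ γ₁ γ₂ s t) z - kernelQ γ₁ γ₂ s t z := fun s t => by
      filter_upwards [coeFn_kernelCutLp h₁ h₂ n s t, coeFn_kernelLp h₁ h₂ s t,
        Lp.coeFn_sub (kernelCutLp h₁ h₂ n s t) (kernelLp h₁ h₂ s t)] with z e1 e2 e3
      rw [hF, e3, Pi.sub_apply, e1, e2]
    filter_upwards [hFz s₂ t₂, hFz s₂ t₁, hFz s₁ t₂, hFz s₁ t₁,
      Lp.coeFn_sub (F s₂ t₂) (F s₂ t₁), Lp.coeFn_sub (F s₂ t₂ - F s₂ t₁) (F s₁ t₂),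
      Lp.coeFn_add (F s₂ t₂ - F s₂ t₁ - F s₁ t₂) (F s₁ t₁)]
      with z e1 e2 e3 e4 e5 e6 e7
    change ‖(F s₂ t₂ - F s₂ t₁ - F s₁ t₂ + F s₁ t₁) z‖ ^ 2 ≤ _
    rw [e7, Pi.add_apply, e6, Pi.sub_apply, e5, Pi.sub_apply, e1, e2, e3, e4]
    simp only [Pi.add_apply]
    by_cases hz : z ∈ cutoff n
    · simp only [Set.indicator_of_mem hz, sub_self, add_zero, norm_zero, zero_pow two_ne_zero]
      positivity
    · simp only [Set.indicator_of_notMem hz, zero_sub]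
      have e : ∀ p q r u : ℂ, ‖-p - -q - -r + -u‖ = ‖p - q - r + u‖ := fun p q r u => by
        rw [← norm_neg]
        congr 1
        ring
      rw [e, kernelQ_rectIncr]
      -- Outside the cutoff at least one of the two frequencies is larger than `n`.
      have hz' : (n : ℝ) < |z 0| ∨ (n : ℝ) < |z 1| := by
        by_contra! hcon
        exact hz hcon
      rcases hz' with hz0 | hz1
      · have := norm_kernelOne_le_of_lt (γ := γ₁) (s := (s₂ : ℝ) - s₁) hδ hn hz0
        calc _ ≤ (((n : ℝ) ^ (-δ)) ^ 2 * ‖kernelOne (γ₁ - δ) ((s₂ : ℝ) - s₁) (z 0)‖ ^ 2)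
              * ‖kernelOne γ₂ ((t₂ : ℝ) - t₁) (z 1)‖ ^ 2 := by gcongr
          _ ≤ _ := by
              rw [mul_assoc]
              refine mul_le_mul_of_nonneg_left ?_ (by positivity)
              exact le_add_of_nonneg_right (by positivity)
      · have := norm_kernelOne_le_of_lt (γ := γ₂) (s := (t₂ : ℝ) - t₁) hδ hn hz1
        calc _ ≤ ‖kernelOne γ₁ ((s₂ : ℝ) - s₁) (z 0)‖ ^ 2
              * (((n : ℝ) ^ (-δ)) ^ 2 * ‖kernelOne (γ₂ - δ) ((t₂ : ℝ) - t₁) (z 1)‖ ^ 2) := by gcongr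
          _ ≤ _ := by
              rw [mul_left_comm]
              refine mul_le_mul_of_nonneg_left ?_ (by positivity)
              exact le_add_of_nonneg_left (by positivity)
  · rw [integral_const_mul]
    simp only [Pi.add_apply]
    rw [integral_add hint hint', hval, hval', integral_norm_sq_kernelOne h₁.1,
      integral_norm_sq_kernelOne h₂.1, integral_norm_sq_kernelOne h₁'.1,
      integral_norm_sq_kernelOne h₂'.1, mul_assoc (((n : ℝ) ^ (-δ)) ^ 2)]
    refine mul_le_mul_of_nonneg_left ?_ (by positivity)
    have hs := rpow_two_mul_le_of_sub hδ hδ₁ (abs_nonneg ((s₂ : ℝ) - s₁)) (abs_sub_le_one s₂ s₁)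
    have ht := rpow_two_mul_le_of_sub hδ hδ₂ (abs_nonneg ((t₂ : ℝ) - t₁)) (abs_sub_le_one t₂ t₁)
    have m1 := kernelMass_nonneg γ₁
    have m2 := kernelMass_nonneg γ₂
    have m1' := kernelMass_nonneg (γ₁ - δ)
    have m2' := kernelMass_nonneg (γ₂ - δ)
    calc _ ≤ |(s₂ : ℝ) - s₁| ^ (2 * (γ₁ - δ)) * kernelMass (γ₁ - δ)
            * (|(t₂ : ℝ) - t₁| ^ (2 * (γ₂ - δ)) * kernelMass γ₂)
          + |(s₂ : ℝ) - s₁| ^ (2 * (γ₁ - δ)) * kernelMass γ₁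
            * (|(t₂ : ℝ) - t₁| ^ (2 * (γ₂ - δ)) * kernelMass (γ₂ - δ)) := by gcongr
      _ = _ := by ring

end Kernel

/-! ### Linearity of the white noise and the law of its increments -/

section WhiteNoise

variable {Ω : Type*} [MeasurableSpace Ω] {P : Measure Ω}
  {W : Lp ℝ 2 (volume : Measure Plane) → Ω → ℝ}

theorem IsWhiteNoise.memLp (hW : IsWhiteNoise P W) (f : Lp ℝ 2 (volume : Measure Plane)) :
    MemLp (W f) 2 P :=
  (hW.gaussian.hasGaussianLaw_eval f).memLp_two

/-- `f ↦ W f`, as a map into `L²(P)`, preserves inner products, hence is additive. -/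
theorem IsWhiteNoise.sub_ae_eq (hW : IsWhiteNoise P W) (f g : Lp ℝ 2 (volume : Measure Plane)) :
    W (f - g) =ᵐ[P] fun ω => W f ω - W g ω := by
  set U : Lp ℝ 2 (volume : Measure Plane) → Lp ℝ 2 P := fun f => (hW.memLp f).toLp (W f) with hU
  have hinner : ∀ f g, inner ℝ (U f) (U g) = inner ℝ f g := fun f g => by
    rw [L2.inner_def, ← hW.covariance f g]
    refine integral_congr_ae ?_
    filter_upwards [(hW.memLp f).coeFn_toLp, (hW.memLp g).coeFn_toLp] with ω e1 e2
    rw [hU, e1, e2, real_inner_eq_re_inner]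
    simp [mul_comm]
  have h0 : U (f - g) = U f - U g := by
    rw [← sub_eq_zero, ← inner_self_eq_zero (𝕜 := ℝ)]
    simp only [inner_sub_left, inner_sub_right, hinner]
    ring
  have h1 := (hW.memLp (f - g)).coeFn_toLp
  have h2 : (U (f - g) : Ω → ℝ) =ᵐ[P] fun ω => U f ω - U g ω := by
    rw [h0]
    exact Lp.coeFn_sub _ _
  filter_upwards [h1, h2, (hW.memLp f).coeFn_toLp, (hW.memLp g).coeFn_toLp] with ω e1 e2 e3 e4
  rw [← e1, ← e3, ← e4]
  exact e2

theorem IsWhiteNoise.zero_ae_eq (hW : IsWhiteNoise P W) : W 0 =ᵐ[P] fun _ => 0 := by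
  simpa using! hW.sub_ae_eq 0 0

theorem IsWhiteNoise.add_ae_eq (hW : IsWhiteNoise P W) (f g : Lp ℝ 2 (volume : Measure Plane)) :
    W (f + g) =ᵐ[P] fun ω => W f ω + W g ω := by
  have h := hW.sub_ae_eq (f + g) g
  rw [add_sub_cancel_right] at h
  filter_upwards [h] with ω e
  rw [e]
  ring

theorem IsWhiteNoise.rectIncr_ae_eq (hW : IsWhiteNoise P W)
    (φ : I → I → Lp ℝ 2 (volume : Measure Plane)) (s₁ s₂ t₁ t₂ : I) :
    W (rectIncr φ s₁ s₂ t₁ t₂) =ᵐ[P]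
      fun ω => planarIncr (fun s t => W (φ s t) ω) s₁ s₂ t₁ t₂ := by
  unfold rectIncr planarIncr
  filter_upwards [hW.sub_ae_eq (φ s₂ t₂) (φ s₂ t₁),
    hW.sub_ae_eq (φ s₂ t₂ - φ s₂ t₁) (φ s₁ t₂),
    hW.add_ae_eq (φ s₂ t₂ - φ s₂ t₁ - φ s₁ t₂) (φ s₁ t₁)] with ω e1 e2 e3
  rw [e3, e2, e1]

theorem IsWhiteNoise.hasLaw (hW : IsWhiteNoise P W) (f : Lp ℝ 2 (volume : Measure Plane)) :
    HasLaw (W f) (gaussianReal 0 (‖f‖ ^ 2).toNNReal) P := by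
  have hG := hW.gaussian.hasGaussianLaw_eval f
  refine ⟨hG.aemeasurable, ?_⟩
  rw [hG.map_eq_gaussianReal, hW.centered f, variance_of_integral_eq_zero hG.aemeasurable
    (hW.centered f)]
  congr 2
  rw [← real_inner_self_eq_norm_sq, ← hW.covariance f f]
  exact integral_congr_ae (Eventually.of_forall fun ω => pow_two _)

/-- The real part of the Fourier transform on `L²`. -/
noncomputable def reFourier (f : Lp ℂ 2 (volume : Measure Plane)) :
    Lp ℝ 2 (volume : Measure Plane) :=
  Complex.reCLM.compLp (𝓕 f)

theorem reFourier_add (f g : Lp ℂ 2 (volume : Measure Plane)) :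
    reFourier (f + g) = reFourier f + reFourier g := by
  unfold reFourier
  rw [FourierTransform.fourier_add]
  exact map_add (Complex.reCLM.compLpₗ 2 (volume : Measure Plane)) _ _

theorem reFourier_sub (f g : Lp ℂ 2 (volume : Measure Plane)) :
    reFourier (f - g) = reFourier f - reFourier g := by
  rw [eq_sub_iff_add_eq, ← reFourier_add, sub_add_cancel]

theorem reFourier_zero : reFourier 0 = 0 := by
  simpa using reFourier_sub 0 0

/-- Half of Plancherel: the real part has norm at most that of the whole transform. -/
theorem norm_reFourier_le (f : Lp ℂ 2 (volume : Measure Plane)) : ‖reFourier f‖ ≤ ‖f‖ := by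
  unfold reFourier
  refine (ContinuousLinearMap.norm_compLp_le _ _).trans ?_
  rw [Complex.reCLM_norm, one_mul, Lp.norm_fourier_eq]

theorem reFourier_rectIncr (φ : I → I → Lp ℂ 2 (volume : Measure Plane)) (s₁ s₂ t₁ t₂ : I) :
    rectIncr (fun s t => reFourier (φ s t)) s₁ s₂ t₁ t₂
      = reFourier (rectIncr φ s₁ s₂ t₁ t₂) := by
  simp only [rectIncr, reFourier_add, reFourier_sub]

theorem hasGaussianIncr_of_ae_eq (hW : IsWhiteNoise P W) {y : I → I → Ω → ℝ}
    {φ : I → I → Lp ℂ 2 (volume : Measure Plane)} {c K a b : ℝ}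
    (hy : ∀ s t, ∀ᵐ ω ∂P, y s t ω = c * W (reFourier (φ s t)) ω)
    (hφ : ∀ s₁ s₂ t₁ t₂, ‖rectIncr φ s₁ s₂ t₁ t₂‖ ^ 2
      ≤ K * (|(s₂ : ℝ) - s₁| ^ (2 * a) * |(t₂ : ℝ) - t₁| ^ (2 * b))) :
    HasGaussianIncr P y (c ^ 2 * K) a b := by
  intro s₁ s₂ t₁ t₂
  have h := gaussianReal_const_mul (hW.hasLaw (reFourier (rectIncr φ s₁ s₂ t₁ t₂))) c
  rw [mul_zero] at h
  refine ⟨_, h.congr ?_, ?_⟩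
  · rw [← reFourier_rectIncr]
    filter_upwards [hW.rectIncr_ae_eq (fun s t => reFourier (φ s t)) s₁ s₂ t₁ t₂,
      hy s₂ t₂, hy s₂ t₁, hy s₁ t₂, hy s₁ t₁] with ω e e1 e2 e3 e4
    rw [e]
    simp only [planarIncr, e1, e2, e3, e4]
    ring
  · rw [NNReal.coe_mul, NNReal.coe_mk, Real.coe_toNNReal _ (by positivity), mul_assoc]
    refine mul_le_mul_of_nonneg_left (le_trans ?_ (hφ s₁ s₂ t₁ t₂)) (sq_nonneg c)
    have := norm_reFourier_le (rectIncr φ s₁ s₂ t₁ t₂)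
    gcongr

end WhiteNoise

/-! ### The sheet and its frequency cutoffs -/

/-- Only the real part of the noise matters for a real-valued version. -/
theorem eq_mul_reFourier_of_eq_fourierNoise {Ω : Type*}
    {W : Lp ℝ 2 (volume : Measure Plane) → Ω → ℝ} {u c : ℝ}
    {f : Lp ℂ 2 (volume : Measure Plane)} {ω : Ω}
    (h : (u : ℂ) = (c : ℂ) * fourierNoise W f ω) : u = c * W (reFourier f) ω := by
  have := congrArg Complex.re h
  simpa [fourierNoise, reFourier] using this

section Sheet

variable {Ω : Type*} [MeasurableSpace Ω] {P : Measure Ω}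
  {W : Lp ℝ 2 (volume : Measure Plane) → Ω → ℝ} {γ₁ γ₂ : ℝ} {h₁ : γ₁ ∈ Set.Ioo (0 : ℝ) 1}
  {h₂ : γ₂ ∈ Set.Ioo (0 : ℝ) 1} {x y : I → I → Ω → ℝ} {n : ℕ}

theorem IsCutoffSheet.hasGaussianIncr (hW : IsWhiteNoise P W) (hy : IsCutoffSheet P W h₁ h₂ n y) :
    HasGaussianIncr P y ((normConst γ₁ * normConst γ₂) ^ 2 * (kernelMass γ₁ * kernelMass γ₂))
      γ₁ γ₂ := by
  refine hasGaussianIncr_of_ae_eq hW (φ := fun s t => kernelCutLp h₁ h₂ n s t) (fun s t => ?_)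
    (norm_sq_rectIncr_kernelCutLp_le h₁ h₂ n)
  filter_upwards [hy.repr s t] with ω e
  exact eq_mul_reFourier_of_eq_fourierNoise e

theorem hasGaussianIncr_cut_sub (hW : IsWhiteNoise P W) (hx : IsSheet P W h₁ h₂ x)
    (hy : IsCutoffSheet P W h₁ h₂ n y) {δ : ℝ} (hδ : 0 < δ) (hδ₁ : δ < γ₁) (hδ₂ : δ < γ₂)
    (hn : 0 < n) :
    HasGaussianIncr P (fun s t ω => y s t ω - x s t ω)
      ((normConst γ₁ * normConst γ₂) ^ 2 * (((n : ℝ) ^ (-δ)) ^ 2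
        * (kernelMass (γ₁ - δ) * kernelMass γ₂ + kernelMass γ₁ * kernelMass (γ₂ - δ))))
      (γ₁ - δ) (γ₂ - δ) := by
  refine hasGaussianIncr_of_ae_eq hW
    (φ := fun s t => kernelCutLp h₁ h₂ n s t - kernelLp h₁ h₂ s t) (fun s t => ?_)
    (norm_sq_rectIncr_cut_sub_le h₁ h₂ hδ hδ₁ hδ₂ hn)
  filter_upwards [hy.repr s t, hx.repr s t, hW.sub_ae_eq (reFourier (kernelCutLp h₁ h₂ n s t))
    (reFourier (kernelLp h₁ h₂ s t))] with ω e1 e2 e3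
  rw [reFourier_sub, e3, mul_sub, ← eq_mul_reFourier_of_eq_fourierNoise e1,
    ← eq_mul_reFourier_of_eq_fourierNoise e2]

theorem kernelCutLp_eq_zero {s t : ℝ} (h : s = 0 ∨ t = 0) : kernelCutLp h₁ h₂ n s t = 0 := by
  rw [Lp.eq_zero_iff_ae_eq_zero]
  refine (coeFn_kernelCutLp h₁ h₂ n s t).trans (Eventually.of_forall fun z => ?_)
  have : kernelQ γ₁ γ₂ s t = 0 := by
    ext z
    rcases h with rfl | rfl <;> simp [kernelQ, kernelOne]
  simp [this]

theorem IsCutoffSheet.ae_eq_zero (hW : IsWhiteNoise P W) (hy : IsCutoffSheet P W h₁ h₂ n y)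
    {s t : I} (h : s = 0 ∨ t = 0) : ∀ᵐ ω ∂P, y s t ω = 0 := by
  filter_upwards [hy.repr s t, hW.zero_ae_eq] with ω e e0
  have hst : (s : ℝ) = 0 ∨ (t : ℝ) = 0 := h.imp (fun e => by simp [e]) (fun e => by simp [e])
  have := eq_mul_reFourier_of_eq_fourierNoise e
  rwa [kernelCutLp_eq_zero hst, reFourier_zero, e0, mul_zero] at this

/-- A cutoff sheet vanishes on both axes, simultaneously at all their points: by continuity it is
enough to look at a countable dense set of points. -/
theorem IsCutoffSheet.ae_forall_eq_zero (hW : IsWhiteNoise P W)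
    (hy : IsCutoffSheet P W h₁ h₂ n y) :
    ∀ᵐ ω ∂P, (∀ t, y 0 t ω = 0) ∧ ∀ s, y s 0 ω = 0 := by
  have e1 : ∀ᵐ ω ∂P, ∀ i : ℕ, y 0 (TopologicalSpace.denseSeq I i) ω = 0 :=
    ae_all_iff.2 fun i => hy.ae_eq_zero hW (Or.inl rfl)
  have e2 : ∀ᵐ ω ∂P, ∀ i : ℕ, y (TopologicalSpace.denseSeq I i) 0 ω = 0 :=
    ae_all_iff.2 fun i => hy.ae_eq_zero hW (Or.inr rfl)
  filter_upwards [e1, e2, hy.continuous_paths] with ω k1 k2 hc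
  have hd := TopologicalSpace.denseRange_denseSeq I
  constructor
  · have : (fun t => y 0 t ω) = fun _ => 0 := by
      refine hd.equalizer ?_ continuous_const (funext k1)
      exact hc.comp (Continuous.prodMk continuous_const continuous_id)
    exact congrFun this
  · have : (fun s => y s 0 ω) = fun _ => 0 := by
      refine hd.equalizer ?_ continuous_const (funext k2)
      exact hc.comp (Continuous.prodMk continuous_id continuous_const)
    exact congrFun this

end Sheet

/-! ### Moments of the planar Hölder norm and of the supremum -/

theorem lintegral_rpow_le_rpow_lintegral {Ω : Type*} [MeasurableSpace Ω] {P : Measure Ω}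
    [IsProbabilityMeasure P] {S : Ω → ℝ≥0∞} (hS : AEMeasurable S P) {r : ℝ} (hr0 : 0 < r)
    (hr1 : r ≤ 1) : ∫⁻ ω, S ω ^ r ∂P ≤ (∫⁻ ω, S ω ∂P) ^ r := by
  have h := eLpNorm'_le_eLpNorm'_of_exponent_le hr0 hr1 P hS.aestronglyMeasurable
  simp only [eLpNorm', enorm_eq_self, ENNReal.rpow_one, div_one] at h
  rwa [one_div, ENNReal.rpow_inv_le_iff hr0] at h

section Moments

variable {Ω : Type*} [MeasurableSpace Ω] {P : Measure Ω} [IsProbabilityMeasure P]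

theorem lintegral_planarHolder_rpow_le {y : I → I → Ω → ℝ} {A a b α β p : ℝ} {m : ℕ}
    (hy : HasGaussianIncr P y A a b) (hA : 0 ≤ A)
    (hc : ∀ᵐ ω ∂P, Continuous fun z : I × I => y z.1 z.2 ω) (hα : 0 < α) (hβ : 0 < β)
    (hαa : α < a) (hβb : β < b) (hm : m ≠ 0) (hp : 0 < p) (hpm : p ≤ ((2 * m : ℕ) : ℝ)) :
    ∫⁻ ω, planarHolder α β (fun s t => y s t ω) ^ p ∂P
      ≤ ENNReal.ofReal (chainConst α * chainConst β) ^ p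
        * (ENNReal.ofReal (A ^ m) * chainMoment m (a - α) (b - β)) ^ (p / ((2 * m : ℕ) : ℝ)) := by
  have hm' : (0 : ℝ) < ((2 * m : ℕ) : ℝ) := by positivity
  calc ∫⁻ ω, planarHolder α β (fun s t => y s t ω) ^ p ∂P
      ≤ ∫⁻ ω, ENNReal.ofReal (chainConst α * chainConst β) ^ p
          * dyadicSum α β m 0 (fun s t => y s t ω) ^ (p / ((2 * m : ℕ) : ℝ)) ∂P := by
        refine lintegral_mono_ae ?_
        filter_upwards [hc] with ω hω
        refine (ENNReal.rpow_le_rpow (planarHolder_le_dyadicSum hα hβ hm hω) hp.le).trans_eq ?_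
        rw [ENNReal.mul_rpow_of_nonneg _ _ hp.le, ← ENNReal.rpow_mul, one_div, inv_mul_eq_div]
    _ = ENNReal.ofReal (chainConst α * chainConst β) ^ p
          * ∫⁻ ω, dyadicSum α β m 0 (fun s t => y s t ω) ^ (p / ((2 * m : ℕ) : ℝ)) ∂P :=
        lintegral_const_mul'' _ ((hy.aemeasurable_dyadicSum α β m 0).pow_const _)
    _ ≤ _ := by
        gcongr
        refine (lintegral_rpow_le_rpow_lintegral (hy.aemeasurable_dyadicSum α β m 0)
          (by positivity) ((div_le_one hm').2 hpm)).trans ?_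
        exact ENNReal.rpow_le_rpow (hy.lintegral_dyadicSum_le hA hαa hβb le_rfl (by norm_num))
          (by positivity)

theorem lintegral_exp_iSup_sq_le {y : I → I → Ω → ℝ} {A a b α β lam : ℝ} {m : ℕ}
    (hy : HasGaussianIncr P y A a b) (hA : 0 ≤ A)
    (hc : ∀ᵐ ω ∂P, Continuous fun z : I × I => y z.1 z.2 ω)
    (h0 : ∀ᵐ ω ∂P, (∀ t, y 0 t ω = 0) ∧ ∀ s, y s 0 ω = 0) (hα : 0 < α) (hβ : 0 < β)
    (hαa : α < a) (hβb : β < b) (hl : 0 < lam) (hlA : lam * A ≤ 1 / 4) :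
    ∫⁻ ω, ENNReal.ofReal (Real.exp (lam / (chainConst α * chainConst β) ^ 2
        * ⨆ z : I × I, |y z.1 z.2 ω| ^ 2)) ∂P
      ≤ ENNReal.ofReal (Real.exp 1) + ENNReal.ofReal (lam ^ m)
        * (ENNReal.ofReal (A ^ m) * chainMoment m (a - α) (b - β)) := by
  calc _ ≤ ∫⁻ ω, (ENNReal.ofReal (Real.exp 1)
          + ENNReal.ofReal (lam ^ m) * dyadicSum α β m lam (fun s t => y s t ω)) ∂P := by
        refine lintegral_mono_ae ?_
        filter_upwards [hc, h0] with ω hω hω0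
        exact exp_iSup_sq_le_dyadicSum (f := fun s t => y s t ω) hα hβ hl hω hω0.1 hω0.2
    _ = ENNReal.ofReal (Real.exp 1) + ENNReal.ofReal (lam ^ m)
          * ∫⁻ ω, dyadicSum α β m lam (fun s t => y s t ω) ∂P := by
        rw [lintegral_add_left measurable_const, lintegral_const, measure_univ, mul_one,
          lintegral_const_mul'' _ (hy.aemeasurable_dyadicSum α β m lam)]
    _ ≤ _ := by
        gcongr
        exact hy.lintegral_dyadicSum_le hA hαa hβb hl.le hlA

end Moments

end FracSheet

theorem mainTheorem10 {Ω : Type*} [MeasurableSpace Ω] (P : Measure Ω) [IsProbabilityMeasure P]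
    (W : Lp ℝ 2 (volume : Measure FracSheet.Plane) → Ω → ℝ) (hW : FracSheet.IsWhiteNoise P W)
    (γ₁ γ₂ : ℝ) (h₁ : γ₁ ∈ Set.Ioo (0 : ℝ) 1) (h₂ : γ₂ ∈ Set.Ioo (0 : ℝ) 1)
    (x : I → I → Ω → ℝ) (hx : FracSheet.IsSheet P W h₁ h₂ x)
    (xn : ℕ → I → I → Ω → ℝ) (hxn : ∀ n, FracSheet.IsCutoffSheet P W h₁ h₂ n (xn n)) :
    (∀ p : ℝ, 1 < p → ∀ ε : ℝ, 0 < ε → ε < min γ₁ γ₂ →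
      Tendsto (fun n : ℕ => ∫⁻ ω,
          FracSheet.planarHolder (γ₁ - ε) (γ₂ - ε) (fun s t => xn n s t ω - x s t ω) ^ p ∂P)
        atTop (𝓝 0)) ∧
    ∃ lam : ℝ, 0 < lam ∧
      (⨆ n : ℕ, ∫⁻ ω, ENNReal.ofReal
        (Real.exp (lam * (⨆ z : I × I, |xn n z.1 z.2 ω| ^ 2))) ∂P) < ⊤ := by
  open FracSheet in
  constructor
  · intro p hp ε hε hεγ
    obtain ⟨hε₁, hε₂⟩ := lt_min_iff.1 hεγ
    -- Half of `ε` pays for the rate of convergence in `n`, the other half for the chaining; the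
    -- moment `2 m` is large enough for the chaining sum to converge.
    obtain ⟨m, hm⟩ := exists_nat_gt (max p (1 / ε))
    obtain ⟨hmp, hmε⟩ := max_lt_iff.1 hm
    have hm0 : (0 : ℝ) < m := by linarith
    have hm0' : m ≠ 0 := by
      rintro rfl
      simp at hm0
    have hmε' : 1 < 2 * m * (ε / 2) := by
      rw [div_lt_iff₀ hε] at hmε
      linarith
    set K := (normConst γ₁ * normConst γ₂) ^ 2 with hK
    set M := kernelMass (γ₁ - ε / 2) * kernelMass γ₂ + kernelMass γ₁ * kernelMass (γ₂ - ε / 2)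
      with hM
    have hM0 : 0 ≤ M := by
      have := kernelMass_nonneg γ₁
      have := kernelMass_nonneg γ₂
      have := kernelMass_nonneg (γ₁ - ε / 2)
      have := kernelMass_nonneg (γ₂ - ε / 2)
      positivity
    have hbound : ∀ᶠ n : ℕ in atTop, ∫⁻ ω,
        planarHolder (γ₁ - ε) (γ₂ - ε) (fun s t => xn n s t ω - x s t ω) ^ p ∂P
        ≤ ENNReal.ofReal (chainConst (γ₁ - ε) * chainConst (γ₂ - ε)) ^ p
          * (ENNReal.ofReal ((K * (((n : ℝ) ^ (-(ε / 2))) ^ 2 * M)) ^ m)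
            * chainMoment m (ε / 2) (ε / 2)) ^ (p / ((2 * m : ℕ) : ℝ)) := by
      filter_upwards [eventually_gt_atTop 0] with n hn
      have hG := hasGaussianIncr_cut_sub hW hx (hxn n) (half_pos hε) (by linarith) (by linarith) hn
      have := lintegral_planarHolder_rpow_le (α := γ₁ - ε) (β := γ₂ - ε) (m := m) (p := p) hG
        (by positivity)
        (by filter_upwards [(hxn n).continuous_paths, hx.continuous_paths] with ω k1 k2
            exact k1.sub k2) (by linarith) (by linarith) (by linarith) (by linarith) hm0'
        (by linarith) (by push_cast; linarith)
      have e₁ : γ₁ - ε / 2 - (γ₁ - ε) = ε / 2 := by ring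
      have e₂ : γ₂ - ε / 2 - (γ₂ - ε) = ε / 2 := by ring
      rwa [e₁, e₂] at this
    refine tendsto_of_tendsto_of_tendsto_of_le_of_le' tendsto_const_nhds ?_
      (Eventually.of_forall fun _ => zero_le) hbound
    have hn : Tendsto (fun n : ℕ => (n : ℝ) ^ (-(ε / 2))) atTop (𝓝 0) :=
      (tendsto_rpow_neg_atTop (half_pos hε)).comp tendsto_natCast_atTop_atTop
    have h1 : Tendsto (fun n : ℕ => ENNReal.ofReal ((K * (((n : ℝ) ^ (-(ε / 2))) ^ 2 * M)) ^ m))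
        atTop (𝓝 0) := by
      have := (((hn.pow 2).mul_const M).const_mul K).pow m
      have := ENNReal.tendsto_ofReal this
      simpa [hm0'] using this
    have h2 := ENNReal.Tendsto.mul_const h1
      (b := chainMoment m (ε / 2) (ε / 2)) (Or.inr (chainMoment_lt_top hmε' hmε').ne)
    rw [zero_mul] at h2
    have h3 := h2.ennrpow_const (p / ((2 * m : ℕ) : ℝ))
    have hpm : 0 < p / ((2 * m : ℕ) : ℝ) := by
      have : (0 : ℝ) < ((2 * m : ℕ) : ℝ) := by positivity
      have : 0 < p := by linarith
      positivity
    rw [ENNReal.zero_rpow_of_pos hpm] at h3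
    have h4 := ENNReal.Tendsto.const_mul h3
      (a := ENNReal.ofReal (chainConst (γ₁ - ε) * chainConst (γ₂ - ε)) ^ p)
      (Or.inr (ENNReal.rpow_ne_top_of_nonneg (by linarith) ENNReal.ofReal_ne_top))
    rwa [mul_zero] at h4
  · have hγ₁ := h₁.1
    have hγ₂ := h₂.1
    set A := (normConst γ₁ * normConst γ₂) ^ 2 * (kernelMass γ₁ * kernelMass γ₂) with hA
    have hA0 : 0 ≤ A := by
      have := kernelMass_nonneg γ₁
      have := kernelMass_nonneg γ₂
      positivity
    -- The chaining uses the exponents `γᵢ / 2`, so that `2 m (γᵢ - γᵢ / 2) > 1` is needed.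
    obtain ⟨m, hm⟩ := exists_nat_gt (max (1 / γ₁) (1 / γ₂))
    obtain ⟨hm₁, hm₂⟩ := max_lt_iff.1 hm
    rw [div_lt_iff₀ hγ₁] at hm₁
    rw [div_lt_iff₀ hγ₂] at hm₂
    have hC₁ := chainConst_pos (half_pos hγ₁)
    have hC₂ := chainConst_pos (half_pos hγ₂)
    -- `A` may vanish a priori, hence `A + 1`; the factor `4` gives `lam * A ≤ 1 / 4`.
    set lam : ℝ := 1 / (4 * (A + 1)) with hlam
    have hl : 0 < lam := by positivity
    have hlA : lam * A ≤ 1 / 4 := by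
      rw [hlam, one_div_mul_eq_div, div_le_div_iff₀ (by positivity) (by norm_num)]
      linarith
    refine ⟨lam / (chainConst (γ₁ / 2) * chainConst (γ₂ / 2)) ^ 2, by positivity,
      lt_of_le_of_lt (iSup_le fun n => lintegral_exp_iSup_sq_le (m := m)
        ((hxn n).hasGaussianIncr hW) hA0 (hxn n).continuous_paths ((hxn n).ae_forall_eq_zero hW)
        (half_pos hγ₁) (half_pos hγ₂) (by linarith) (by linarith) hl hlA) ?_⟩
    have := chainMoment_lt_top (m := m) (a' := γ₁ - γ₁ / 2) (b' := γ₂ - γ₂ / 2) (by linarith)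
      (by linarith)
    finiteness
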